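/- **Setting.** Let $d\ge 1$, let $X=\mathbb R^d$ carry the metric $\mathrm d$ of an $\ell_q$ norm, $1\le q\le\infty$, and let $Y=\{0,1\}$. Let $r>0$, $\gamma>0$, and put $\mathcal U(x)=\{z:\mathrm d(x,z)\le r\}$ and $\mathcal V(x)=\{z:\mathrm d(x,z)\le(1+\gamma)r\}$. Let $C\subseteq X$ be an $r\gamma$-cover, i.e. every $x\in X$ has some $c\in C$ with $\mathrm d(x,c)\le r\gamma$, and put $\mathcal C(x)=\mathcal V(x)\cap C$. Let $\mathcal H\subseteq Y^X$ be nonempty with finite VC-dimension $\mathrm{VC}(\mathcal H)$. For a perturbation type $\mathcal W:X\to 2^X$ let $\ell^{\mathcal W}(h,x,y)=1$ if $h(z)\ne y$ for some $z\in\mathcal W(x)$, and $0$ otherwise; let $L^{\mathcal W}_P(h)=\mathbb E_{(x,y)\sim P}\,\ell^{\mathcal W}(h,x,y)$, let $L^{\mathcal W}_S(h)$ be the average of $\ell^{\mathcal W}(h,\cdot)$ over a labeled sample $S$, and let $L^{\mathcal W}_P(\mathcal H)=\inf_{h\in\mathcal H}L^{\mathcal W}_P(h)$. A hypothesis $h$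 is robust at $x$ if it is constant on $\mathcal C(x)$; this constant is its robust label at $x$. An RERM$^{\mathcal C}_{\mathcal G}$ oracle maps a labeled sample $S$ to some minimizer of $L^{\mathcal C}_S$ over $\mathcal G$. $\mathrm{VC}_{\mathcal C}(\mathcal H)$ is the largest size of a set $K\subseteq X$ such that for every $y\in\{0,1\}^K$ some $h\in\mathcal H$ satisfies $h(z)=y(x)$ for all $x\in K$ and $z\in\mathcal C(x)$. **Algorithm.** The input is a labeled sample $S_l$ of size $m$ and an unlabeled sample $S_u=(x_1,\dots,x_n)$. (1) Let $\mathcal H'$ be the set of the outputs of RERM$^{\mathcal C}_{\mathcal H}$ on $((x_1,y_1),\dots,(x_n,y_n))$, over all labelings $y\in\{0,1\}^n$. (2) Start with $\mathcal H''=\emptyset$. Visit the elements $h$ of $\mathcal H'$ in order of increasing number of points of $S_u$ at which $h$ is not robust (ties in any order), and add $h$ to $\mathcal H''$ if for every $h'$ already in $\mathcal H''$ there is a point of $S_u$ at which $h$ and $h'$ are both robust with different robust labels. (3) Let $\hat h$ be the output of RERM$^{\mathcal C}_{\mathcal H''}$ on $S_l$, and return the hypothesis that gives each $x$ the label $\hat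 h(x')$ of a nearest neighbour $x'$ of $x$ in $C$. **Theorem 5.** There are absolute constants $K>0$ and $p\in\mathbb N$ such that the following holds in the above setting. Let either (i) $C$ be any $r\gamma$-cover with $|\mathcal C(x)|\le k$ for all $x$, where $k\in\mathbb N$, and $D=\max(1,\log k)$; or (ii) $C$ be a grid of side-length $2r\gamma/d$ with any offset, and $D=d\cdot\max\bigl(1,\ \log(1+1/\gamma)+\log d\bigr)$. Then there are functions $m_u(\epsilon,\delta)$ and $m_l(n,\epsilon,\delta)$, the same for all choices of the RERM oracles and of the ties, such that for all $\epsilon,\delta\in(0,1)$ $$m_u(\epsilon,\delta)\le K f\,(\log(2+f))^p,\qquad f=\frac{\mathrm{VC}(\mathcal H)\,D+\log(1/\delta)}{\epsilon^2},$$ and for all $n\ge m_u(\epsilon,\delta)$ $$m_l(n,\epsilon,\delta)\le K\,\frac{\mathrm{VC}_{\mathcal C}(\mathcal H)\log n+\log(1/\delta)}{\epsilon^2}\,(\log(2+n))^p,$$ and the algorithm is a factor-3 agnostic $\gamma$-tolerant robust learner with these sample sizes: for every probability distribution $P$ on $X\times Y$ and all $\epsilon,\delta\in(0,1)$, $n\ge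 m_u(\epsilon,\delta)$ and $m\ge m_l(n,\epsilon,\delta)$, if $S_l\sim P^m$ and $S_u\sim P_X^n$ are independent ($P_X$ is the marginal of $P$ on $X$), then with probability at least $1-\delta$ the returned hypothesis $A(S_l,S_u)$ satisfies $$L^{\mathcal U}_P(A(S_l,S_u))\le 3\,L^{\mathcal V}_P(\mathcal H)+\epsilon.$$ In particular, with $n=m_u$ in case (ii), the unlabeled sample complexity is $\tilde O\bigl((\mathrm{VC}(\mathcal H)\,d(\log(1+1/\gamma)+\log d)+\log(1/\delta))/\epsilon^2\bigr)$, where the factor $\log(1+1/\gamma)+\log d$ is read as at least $1$, and the labeled one is $\tilde O\bigl((\mathrm{VC}_{\mathcal C}(\mathcal H)\log m_u+\log(1/\delta))/\epsilon^2\bigr)$, where $\tilde O$ also hides powers of $\log m_u$. -/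

import Mathlib

open MeasureTheory

noncomputable section

namespace TolerantRobust

/-- A hypothesis assigns a binary label to each point of the domain. -/
abbrev Hyp (X : Type) := X → Bool

/-- A perturbation type assigns to each point its set of admissible perturbations. -/
abbrev Pert (X : Type) := X → Set X

/-- A labeled sample of size `n`. -/
abbrev LSample (X : Type) (n : ℕ) := Fin n → X × Bool

/-- A supervised learning rule: labeled samples of any size to hypotheses. -/
abbrev Rule (X : Type) := (n : ℕ) → LSample X n → Hyp X

/-- A semi-supervised learner: `m` labeled points and `n` unlabeled points to a hypothesis. -/
abbrev SemiLearner (X : Type) := (m n : ℕ) → LSample X m → (Fin n → X) → Hyp X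

section Losses

variable {X : Type}

open Classical in
/-- Adversarial loss: `1` if some admissible perturbation of `x` is mislabeled, else `0`. -/
def advLoss (U : Pert X) (h : Hyp X) (x : X) (y : Bool) : ℝ :=
  if ∃ z ∈ U x, h z ≠ y then 1 else 0

/-- Empirical adversarial loss. -/
def empAdvRisk (U : Pert X) {n : ℕ} (S : LSample X n) (h : Hyp X) : ℝ :=
  (∑ i, advLoss U h (S i).1 (S i).2) / n

/-- Expected adversarial loss: the expectation of the 0/1-valued loss, that is the probability
that the loss is `1` (for a loss set that is not measurable, its outer probability). -/
def advRisk [MeasurableSpace X] (U : Pert X) (P : Measure (X × Bool)) (h : Hyp X) : ℝ :=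
  P.real {p | advLoss U h p.1 p.2 = 1}

/-- Adversarial approximation error of a class. -/
def advApproxError [MeasurableSpace X] (U : Pert X) (P : Measure (X × Bool))
    (H : Set (Hyp X)) : ℝ :=
  sInf (advRisk U P '' H)

open Classical in
/-- Margin loss: `1` if `h` is not constant on the perturbation set of `x`, else `0`. -/
def marginLoss (U : Pert X) (h : Hyp X) (x : X) : ℝ :=
  if ∃ z ∈ U x, ∃ z' ∈ U x, h z ≠ h z' then 1 else 0

/-- Empirical margin loss. -/
def empMarginRisk (U : Pert X) {n : ℕ} (xs : Fin n → X) (h : Hyp X) : ℝ :=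
  (∑ i, marginLoss U h (xs i)) / n

/-- Robust empirical risk minimizers for the class `G` with respect to `U`. -/
def IsRERM (U : Pert X) (G : Set (Hyp X)) (A : Rule X) : Prop :=
  ∀ (n : ℕ) (S : LSample X n), A n S ∈ G ∧ ∀ h ∈ G, empAdvRisk U S (A n S) ≤ empAdvRisk U S h

/-- `H` `U`-shatters `K`: every labeling of `K` is realized by some `h ∈ H`, constantly on the
perturbation set of each point of `K`. -/
def RobustlyShatters (U : Pert X) (H : Set (Hyp X)) (K : Finset X) : Prop :=
  ∀ y : X → Bool, ∃ h ∈ H, ∀ x ∈ K, ∀ z ∈ U x, h z = y x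

/-- The `VC_U`-dimension: supremum of the sizes of `U`-shattered sets. -/
def robustVCDim (U : Pert X) (H : Set (Hyp X)) : ℕ∞ :=
  ⨆ (K : Finset X) (_ : RobustlyShatters U H K), (K.card : ℕ∞)

/-- `H` shatters `K`: every labeling of `K` is realized by some `h ∈ H`. -/
def ClassShatters (H : Set (Hyp X)) (K : Finset X) : Prop :=
  ∀ y : X → Bool, ∃ h ∈ H, ∀ x ∈ K, h x = y x

/-- The VC-dimension: supremum of the sizes of shattered sets. -/
def classVCDim (H : Set (Hyp X)) : ℕ∞ :=
  ⨆ (K : Finset X) (_ : ClassShatters H K), (K.card : ℕ∞)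

end Losses

section Algorithm

variable {X : Type}

open Classical in
/-- First loop: run the RERM rule `A` on all labelings of the unlabeled sample. -/
def candidates (A : Rule X) {n : ℕ} (xs : Fin n → X) : Finset (Hyp X) :=
  Finset.univ.image fun y : Fin n → Bool => A n fun i => (xs i, y i)

/-- `h` and `h'` are both robust on some point of the unlabeled sample, with different robust
labels there. -/
def RobustlyDiffer (U : Pert X) {n : ℕ} (xs : Fin n → X) (h h' : Hyp X) : Prop :=
  ∃ i, marginLoss U h (xs i) = 0 ∧ marginLoss U h' (xs i) = 0 ∧ ∃ z ∈ U (xs i), h z ≠ h' z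

/-- `enum` lists the elements of each finite set of hypotheses in some order, once each. -/
def IsEnumeration (enum : Finset (Hyp X) → List (Hyp X)) : Prop :=
  ∀ G, (enum G : Multiset (Hyp X)) = G.val

open Classical in
/-- The order in which the pruning loop visits the candidates: for `s = 0, …, n`, those with
empirical margin loss `s / n`, in the order in which `enum` lists them. -/
def visitOrder (U : Pert X) (enum : Finset (Hyp X) → List (Hyp X)) {n : ℕ} (xs : Fin n → X)
    (G : Finset (Hyp X)) : List (Hyp X) :=
  (List.range (n + 1)).flatMap fun s =>
    (enum G).filter fun h => decide (empMarginRisk U xs h = (s : ℝ) / n)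

open Classical in
/-- Second loop: a visited candidate is kept if it robustly differs, on the unlabeled sample, from
every hypothesis kept so far. -/
def prunedClass (U : Pert X) (enum : Finset (Hyp X) → List (Hyp X)) {n : ℕ} (xs : Fin n → X)
    (G : Finset (Hyp X)) : Finset (Hyp X) :=
  (visitOrder U enum xs G).foldl
    (fun kept h => if ∀ h' ∈ kept, RobustlyDiffer U xs h h' then insert h kept else kept) ∅

/-- `nn x` is a nearest neighbour of `x` in `C`. -/
def IsNearest [PseudoMetricSpace X] (C : Set X) (nn : X → X) : Prop :=
  ∀ x, nn x ∈ C ∧ ∀ c ∈ C, dist x (nn x) ≤ dist x c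

/-- The pruned semi-supervised agnostic algorithm: prune the candidates, run the RERM rule of the
pruned class on the labeled sample, and relabel each point by its nearest neighbour. -/
def prunedLearner (U : Pert X) (A : Rule X) (B : Finset (Hyp X) → Rule X)
    (enum : Finset (Hyp X) → List (Hyp X)) (nn : X → X) : SemiLearner X :=
  fun m _ Sl xs x => B (prunedClass U enum xs (candidates A xs)) m Sl (nn x)

end Algorithm

section Learning

variable {X : Type}

/-- Factor-`α` agnostic `(U, V)`-tolerant semi-supervised robust learning of `H` by `L`, for all
distributions `P`, from `n ≥ mu ε δ` unlabeled and `m ≥ ml n ε δ` labeled points, all independent: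
the requirement on the labeled sample is relative to the size `n` of the unlabeled one. The
success event need not be measurable for an arbitrary learner; its measure is then the outer one. -/
def TolerantlyLearns [MeasurableSpace X] (α : ℝ) (U V : Pert X) (H : Set (Hyp X))
    (L : SemiLearner X) (mu : ℝ → ℝ → ℕ) (ml : ℕ → ℝ → ℝ → ℕ) : Prop :=
  ∀ P : Measure (X × Bool), IsProbabilityMeasure P →
    ∀ ε ∈ Set.Ioo (0 : ℝ) 1, ∀ δ ∈ Set.Ioo (0 : ℝ) 1,
      ∀ n, mu ε δ ≤ n → ∀ m, ml n ε δ ≤ m →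
        ENNReal.ofReal (1 - δ) ≤
          ((Measure.pi fun _ : Fin m => P).prod
              (Measure.pi fun _ : Fin n => P.map Prod.fst))
            {S | advRisk U P (L m n S.1 S.2) ≤ α * advApproxError V P H + ε}

/-- The perturbation type of closed balls of radius `ρ`. -/
def ballPert [PseudoMetricSpace X] (ρ : ℝ) : Pert X := fun x => Metric.closedBall x ρ

/-- The discretized perturbation type induced by `C`. -/
def discPert [PseudoMetricSpace X] (C : Set X) (ρ : ℝ) : Pert X :=
  fun x => Metric.closedBall x ρ ∩ C

/-- `C` is a `ρ`-cover of the space. -/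
def IsCover [PseudoMetricSpace X] (C : Set X) (ρ : ℝ) : Prop :=
  ∀ x, ∃ c ∈ C, dist x c ≤ ρ

/-- The unlabeled rate `(VC(H) * D + log (1/δ)) / ε²`. -/
def unlabeledRate (H : Set (Hyp X)) (D ε δ : ℝ) : ℝ :=
  ((classVCDim H).toNat * D + Real.log (1 / δ)) / ε ^ 2

/-- The labeled rate `(VC_U(H) * log n + log (1/δ)) / ε²`, with `n` unlabeled points. -/
def labeledRate (U : Pert X) (H : Set (Hyp X)) (n : ℕ) (ε δ : ℝ) : ℝ :=
  ((robustVCDim U H).toNat * Real.log n + Real.log (1 / δ)) / ε ^ 2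

/-- With actual radius `r`, tolerance `γ` and discretization `C`, the pruned algorithm is a
factor-3 agnostic tolerant learner of `H`, whatever RERM rules, order of enumeration and
nearest-neighbour ties it uses, with sample sizes that do not depend on these choices. The unlabeled
one is `K * f * (log (2 + f)) ^ p` at most, where `f` is the unlabeled rate, and the labeled one,
with `n` unlabeled points, `K * g * (log (2 + n)) ^ p` at most, where `g` is the labeled rate. -/
def PrunedGuarantee [PseudoMetricSpace X] [MeasurableSpace X] (K : ℝ) (p : ℕ) (r γ : ℝ) (C : Set X)
    (H : Set (Hyp X)) (D : ℝ) : Prop :=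
  ∃ (mu : ℝ → ℝ → ℕ) (ml : ℕ → ℝ → ℝ → ℕ),
    (∀ ε ∈ Set.Ioo (0 : ℝ) 1, ∀ δ ∈ Set.Ioo (0 : ℝ) 1,
      (mu ε δ : ℝ) ≤ K * unlabeledRate H D ε δ * Real.log (2 + unlabeledRate H D ε δ) ^ p ∧
      ∀ n, mu ε δ ≤ n →
        (ml n ε δ : ℝ) ≤
          K * labeledRate (discPert C ((1 + γ) * r)) H n ε δ * Real.log (2 + n) ^ p) ∧
    ∀ (A : Rule X) (B : Finset (Hyp X) → Rule X) (enum : Finset (Hyp X) → List (Hyp X))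
      (nn : X → X),
      IsRERM (discPert C ((1 + γ) * r)) H A →
      (∀ G : Finset (Hyp X), G.Nonempty → IsRERM (discPert C ((1 + γ) * r)) ↑G (B G)) →
      IsEnumeration enum → IsNearest C nn →
      TolerantlyLearns 3 (ballPert r) (ballPert ((1 + γ) * r)) H
        (prunedLearner (discPert C ((1 + γ) * r)) A B enum nn) mu ml

end Learning

/-- Evenly spaced grid points in `ℝ^d` (with the `ℓ_q` norm), of side-length `s` and offset `b`. -/
def grid (d : ℕ) (q : ENNReal) (s : ℝ) (b : Fin d → ℝ) : Set (PiLp q fun _ : Fin d => ℝ) :=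
  {x | ∀ i, ∃ j : ℤ, x i = b i + s * j}

end TolerantRobust

end

/-! All risks are compared through the discretized sets, the points of `C` in the larger ball.
Passing from that ball to its points in `C` only drops perturbations, and relabeling by nearest
neighbours turns a discretized risk into a bound on the risk for the smaller ball
(`advRisk_comp_nearest_le`). So it suffices to learn for the discretized loss, which is measurable
even for non-measurable hypotheses, because `C` is countable.

The labels of the unlabeled points are unseen, but one of the labelings tried is the true one, so
some candidate g is a robust empirical minimizer over `H`. Visiting by increasing margin loss
ensures that a kept h' has margin loss at most that of g and does not robustly differ from g. Where
h' errs, either h' is not robust or g errs too; as margin loss is at most adversarial loss, h' has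
at most twice the optimal empirical risk (`exists_mem_prunedClass_empAdvRisk_le`). Uniform
convergence over `H` carries this to true risks: the loss on `2 * n` examples depends only on the
values at `2 * n * k` points, so Sauer's lemma and symmetrization apply, and `VC(H)` and `log k`
enter only the unlabeled rate.

Kept hypotheses are partial labelings, defined at robust points, any two of which are opposite
somewhere on the sample. The sets they shatter are robustly shattered by `H`, hence at most `(n + 1)
^ d` in number with `d` the robust dimension, and the recursion of `card_le_of_pairwiseOpposite`
bounds the pruned class by n to the power O(d log n). Given the unlabeled sample, Hoeffding and a
union bound over this finite class give the labeled rate. The argument in fact yields factor 2; the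
factor 3 is slack.

The rates have no additive constant and can be arbitrarily small when a dimension is zero; there the
class, or the pruned class, has one element and no sample is needed. -/

noncomputable section

namespace TolerantRobust

/-! ### Shattering by partial labelings, and Sauer's lemma. -/

section Combinatorics

variable {α ι : Type}

/-- The family `F` of partial labelings `v i` shatters `K`. -/
def PartialShatters (v : ι → α → Option Bool) (F : Finset ι) (K : Finset α) : Prop :=
  ∀ y : α → Bool, ∃ i ∈ F, ∀ x ∈ K, v i x = some (y x)

/-- Any two members of the family `F` of partial labelings `v i` have opposite labels at some point
of `T`. -/
def PairwiseOpposite (v : ι → α → Option Bool) (F : Finset ι) (T : Finset α) : Prop :=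
  ∀ i ∈ F, ∀ j ∈ F, i ≠ j → ∃ x ∈ T, ∃ b, v i x = some b ∧ v j x = some (!b)

open Classical in
/-- The subsets of `T` shattered by a family of partial labelings. -/
def partialShatterer (v : ι → α → Option Bool) (F : Finset ι) (T : Finset α) :
    Finset (Finset α) :=
  T.powerset.filter (PartialShatters v F)

theorem PartialShatters.mono {v : ι → α → Option Bool} {F G : Finset ι} {K : Finset α}
    (h : PartialShatters v F K) (hFG : F ⊆ G) : PartialShatters v G K := fun y => by
  obtain ⟨i, hi, hv⟩ := h y
  exact ⟨i, hFG hi, hv⟩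

-- A set shattered by either half is shattered by `F`. One shattered by both halves is counted twice
-- on the left, but then its union with `x` is shattered too: take the value at `x` from the
-- appropriate half. Labelings undefined at `x` are simply dropped.
open Classical in
theorem card_partialShatterer_add_le (v : ι → α → Option Bool) (F : Finset ι) (T : Finset α)
    (x : α) (hx : x ∉ T) :
    (partialShatterer v (F.filter fun i => v i x = some false) T).card +
        (partialShatterer v (F.filter fun i => v i x = some true) T).card ≤
      (partialShatterer v F (insert x T)).card := by
  set A := partialShatterer v (F.filter fun i => v i x = some false) T with hA
  set B := partialShatterer v (F.filter fun i => v i x = some true) T with hB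
  have hAT : ∀ K ∈ A ∪ B, K ⊆ T := by
    intro K hK
    rcases Finset.mem_union.1 hK with h | h <;>
      exact Finset.mem_powerset.1 (Finset.mem_filter.1 h).1
  have hinj : Set.InjOn (fun K : Finset α => insert x K) (A ∩ B : Finset (Finset α)) := by
    intro K hK L hL h
    have hK' : x ∉ K := fun h => hx (hAT K
      (Finset.mem_union_left _ (Finset.mem_inter.1 (Finset.mem_coe.1 hK)).1) h)
    have hL' : x ∉ L := fun h => hx (hAT L
      (Finset.mem_union_left _ (Finset.mem_inter.1 (Finset.mem_coe.1 hL)).1) h)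
    have := congrArg (fun M => Finset.erase M x) h
    simpa [Finset.erase_insert hK', Finset.erase_insert hL'] using this
  have hdisj : Disjoint (A ∪ B) ((A ∩ B).image fun K => insert x K) := by
    rw [Finset.disjoint_left]
    intro K hK hK'
    obtain ⟨L, -, rfl⟩ := Finset.mem_image.1 hK'
    exact hx (hAT _ hK (Finset.mem_insert_self x L))
  rw [← Finset.card_union_add_card_inter, ← Finset.card_image_of_injOn hinj,
    ← Finset.card_union_of_disjoint hdisj]
  refine Finset.card_le_card fun K hK => ?_
  rcases Finset.mem_union.1 hK with h | h
  · refine Finset.mem_filter.2 ⟨Finset.mem_powerset.2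
      ((hAT K h).trans (Finset.subset_insert x T)), ?_⟩
    rcases Finset.mem_union.1 h with h | h <;>
      exact (Finset.mem_filter.1 h).2.mono (Finset.filter_subset _ _)
  · obtain ⟨L, hL, rfl⟩ := Finset.mem_image.1 h
    obtain ⟨hLA, hLB⟩ := Finset.mem_inter.1 hL
    refine Finset.mem_filter.2 ⟨Finset.mem_powerset.2 (Finset.insert_subset_insert x
      (hAT L (Finset.mem_union_left _ hLA))), fun y => ?_⟩
    have key : ∃ i ∈ F, v i x = some (y x) ∧ ∀ z ∈ L, v i z = some (y z) := by
      cases hy : y x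
      · obtain ⟨i, hi, hv⟩ := (Finset.mem_filter.1 hLA).2 y
        exact ⟨i, (Finset.mem_filter.1 hi).1, (Finset.mem_filter.1 hi).2, hv⟩
      · obtain ⟨i, hi, hv⟩ := (Finset.mem_filter.1 hLB).2 y
        exact ⟨i, (Finset.mem_filter.1 hi).1, (Finset.mem_filter.1 hi).2, hv⟩
    obtain ⟨i, hi, hix, hv⟩ := key
    refine ⟨i, hi, fun z hz => ?_⟩
    rcases Finset.mem_insert.1 hz with rfl | hz
    · exact hix
    · exact hv z hz

open Classical in
/-- A family of pairwise opposite partial labelings that shatters few sets is small. -/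
theorem card_le_of_pairwiseOpposite (v : ι → α → Option Bool) (T : Finset α) :
    ∀ (F : Finset ι) (j : ℕ), PairwiseOpposite v F T → (partialShatterer v F T).card < 2 ^ j →
      F.card ≤ (T.card + 1) ^ j := by
  induction T using Finset.induction_on with
  | empty =>
    intro F j hF _
    simp only [Finset.card_empty, zero_add, one_pow]
    refine Finset.card_le_one.2 fun a ha b hb => by_contra fun hab => ?_
    obtain ⟨x, hx, -⟩ := hF a ha b hb hab
    simp at hx
  | insert x T hx ih =>
    intro F j hF hj
    rcases j with _ | j
    · have h0 : partialShatterer v F (insert x T) = ∅ := by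
        rw [← Finset.card_eq_zero]; simpa using hj
      have : F = ∅ := by
        by_contra hne
        obtain ⟨i, hi⟩ := Finset.nonempty_iff_ne_empty.2 hne
        have : (∅ : Finset α) ∈ partialShatterer v F (insert x T) :=
          Finset.mem_filter.2 ⟨Finset.empty_mem_powerset _, fun y => ⟨i, hi, by simp⟩⟩
        simp [h0] at this
      simp [this]
    · have hsum := card_partialShatterer_add_le v F T x hx
      -- The two halves share fewer than `2 ^ (j + 1)` shattered sets, so one of them loses a factor
      -- of two. Its members agree at `x`, hence are still separated on `T`.
      have hb : ∃ b, (partialShatterer v (F.filter fun i => v i x = some b) T).card < 2 ^ j := by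
        by_contra! hcon
        have h0 := hcon false
        have h1 := hcon true
        rw [pow_succ] at hj
        omega
      obtain ⟨b, hb⟩ := hb
      have h1 : (F.filter fun i => v i x = some b).card ≤ (T.card + 1) ^ j := by
        refine ih _ j (fun i hi i' hi' hne => ?_) hb
        obtain ⟨hi, hib⟩ := Finset.mem_filter.1 hi
        obtain ⟨hi', hib'⟩ := Finset.mem_filter.1 hi'
        obtain ⟨z, hz, c, hc, hc'⟩ := hF i hi i' hi' hne
        rcases Finset.mem_insert.1 hz with rfl | hz
        · rw [hc] at hib; rw [hc'] at hib'; simp_all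
        · exact ⟨z, hz, c, hc, hc'⟩
      -- Outside that half nobody has label `b` at `x`, so no pair is opposite there; the exponent
      -- stays, but `T` is smaller.
      have h2 : (F.filter fun i => ¬ v i x = some b).card ≤ (T.card + 1) ^ (j + 1) := by
        refine ih _ (j + 1) (fun i hi i' hi' hne => ?_) (lt_of_le_of_lt
          (Finset.card_le_card fun K hK => ?_) hj)
        · obtain ⟨hi, hib⟩ := Finset.mem_filter.1 hi
          obtain ⟨hi', hib'⟩ := Finset.mem_filter.1 hi'
          obtain ⟨z, hz, c, hc, hc'⟩ := hF i hi i' hi' hne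
          rcases Finset.mem_insert.1 hz with rfl | hz
          · rw [hc] at hib; rw [hc'] at hib'
            cases b <;> cases c <;> simp_all
          · exact ⟨z, hz, c, hc, hc'⟩
        · obtain ⟨hKT, hK⟩ := Finset.mem_filter.1 hK
          exact Finset.mem_filter.2 ⟨Finset.mem_powerset.2 ((Finset.mem_powerset.1 hKT).trans
            (Finset.subset_insert x T)), hK.mono (Finset.filter_subset _ _)⟩
      rw [← Finset.card_filter_add_card_filter_not (s := F) (fun i => v i x = some b),
        Finset.card_insert_of_notMem hx]
      have h3 : (T.card + 1) ^ j ≤ (T.card + 1 + 1) ^ j := Nat.pow_le_pow_left (by omega) j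
      calc _ ≤ (T.card + 1) ^ j + (T.card + 1) ^ (j + 1) := Nat.add_le_add h1 h2
        _ = (T.card + 1) ^ j * (T.card + 1 + 1) := by ring
        _ ≤ (T.card + 1 + 1) ^ j * (T.card + 1 + 1) := Nat.mul_le_mul_right _ h3
        _ = _ := (pow_succ _ _).symm

theorem sum_choose_le_pow (n d : ℕ) : ∑ k ∈ Finset.Iic d, n.choose k ≤ (n + 1) ^ d := by
  induction d with
  | zero => simp [show Finset.Iic 0 = {0} from rfl]
  | succ d ih =>
    have h : Finset.Iic (d + 1) = insert (d + 1) (Finset.Iic d) := by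
      ext k; simp; omega
    rw [h, Finset.sum_insert (by simp)]
    have h1 : n.choose (d + 1) ≤ n ^ (d + 1) := Nat.choose_le_pow n (d + 1)
    have h2 : n ^ d ≤ (n + 1) ^ d := Nat.pow_le_pow_left (by omega) d
    calc _ ≤ n ^ d * n + (n + 1) ^ d := Nat.add_le_add h1 ih
      _ ≤ (n + 1) ^ d * n + (n + 1) ^ d := Nat.add_le_add_right (Nat.mul_le_mul_right _ h2) _
      _ = _ := by ring

theorem card_filter_powerset_le (T : Finset α) (d : ℕ) :
    (T.powerset.filter fun K => K.card ≤ d).card ≤ (T.card + 1) ^ d := by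
  classical
  refine le_trans ?_ (sum_choose_le_pow T.card d)
  calc _ ≤ ((Finset.Iic d).biUnion fun k => T.powersetCard k).card := by
        refine Finset.card_le_card fun K hK => ?_
        simp only [Finset.mem_filter, Finset.mem_powerset] at hK
        simp [Finset.mem_powersetCard, hK.1, hK.2]
    _ ≤ ∑ k ∈ Finset.Iic d, (T.powersetCard k).card := Finset.card_biUnion_le
    _ = _ := by simp [Finset.card_powersetCard]

theorem card_le_classVCDim {H : Set (Hyp α)} {K : Finset α} (hH : classVCDim H < ⊤)
    (hK : ClassShatters H K) : K.card ≤ (classVCDim H).toNat := by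
  have h : (K.card : ℕ∞) ≤ classVCDim H := le_iSup₂_of_le K hK le_rfl
  rw [← ENat.natCast_toNat hH.ne] at h
  exact_mod_cast h

theorem card_le_robustVCDim {U : Pert α} {H : Set (Hyp α)} {K : Finset α}
    (hH : robustVCDim U H < ⊤) (hK : RobustlyShatters U H K) :
    K.card ≤ (robustVCDim U H).toNat := by
  have h : (K.card : ℕ∞) ≤ robustVCDim U H := le_iSup₂_of_le K hK le_rfl
  rw [← ENat.natCast_toNat hH.ne] at h
  exact_mod_cast h

/-- Robust shattering of `K` yields ordinary shattering of a set of the same size. -/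
theorem robustVCDim_le_classVCDim {U : Pert α} {H : Set (Hyp α)} (hU : ∀ x, (U x).Nonempty) :
    robustVCDim U H ≤ classVCDim H := by
  classical
  refine iSup₂_le fun K hK => ?_
  choose c hc using hU
  have hinj : Set.InjOn c K := by
    intro x hx x' hx' hcc
    by_contra hne
    obtain ⟨h, -, hh⟩ := hK fun z => decide (z = x)
    have h1 := hh x hx _ (hc x)
    have h2 := hh x' hx' _ (hc x')
    rw [hcc, h2] at h1
    simp [Ne.symm hne] at h1
  rw [← Finset.card_image_of_injOn hinj]
  refine le_iSup₂_of_le (K.image c) (fun y => ?_) le_rfl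
  obtain ⟨h, hH, hh⟩ := hK fun z => y (c z)
  refine ⟨h, hH, fun x hx => ?_⟩
  obtain ⟨z, hz, rfl⟩ := Finset.mem_image.1 hx
  exact hh z hz _ (hc z)

/-- Sauer's lemma: few members of `H` represent all restrictions of `H` to a finite set. -/
theorem exists_representatives {H : Set (Hyp α)} (hH : classVCDim H < ⊤) (T : Finset α) :
    ∃ R : Finset (Hyp α), ↑R ⊆ H ∧ R.card ≤ (T.card + 1) ^ (classVCDim H).toNat ∧
      ∀ h ∈ H, ∃ h' ∈ R, ∀ x ∈ T, h x = h' x := by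
  classical
  let 𝒜 : Finset (Finset α) := T.powerset.filter fun u => ∃ h ∈ H, T.filter (fun x => h x) = u
  have hr : ∀ u ∈ 𝒜, ∃ h ∈ H, T.filter (fun x => h x) = u := fun u hu => (Finset.mem_filter.1 hu).2
  choose! g hgH hg using hr
  refine ⟨𝒜.image g, ?_, ?_, ?_⟩
  · intro h hh
    obtain ⟨u, hu, rfl⟩ := Finset.mem_image.1 (Finset.mem_coe.1 hh)
    exact hgH u hu
  -- A set family has at most as many members as it shatters sets.
  · refine Finset.card_image_le.trans (𝒜.card_le_card_shatterer.trans (le_trans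
      (Finset.card_le_card fun K hK => ?_) (card_filter_powerset_le T _)))
    have hK' := Finset.mem_shatterer.1 hK
    have hKT : K ⊆ T := by
      obtain ⟨u, hu, hKu⟩ := hK' (Finset.Subset.refl K)
      exact (Finset.inter_eq_left.1 hKu).trans
        (Finset.mem_powerset.1 (Finset.mem_filter.1 hu).1)
    refine Finset.mem_filter.2 ⟨Finset.mem_powerset.2 hKT, card_le_classVCDim hH fun y => ?_⟩
    obtain ⟨u, hu, hKu⟩ := hK' (Finset.filter_subset (fun x => y x) K)
    obtain ⟨-, h, hh, rfl⟩ := Finset.mem_filter.1 hu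
    refine ⟨h, hh, fun x hx => ?_⟩
    have := Finset.ext_iff.1 hKu x
    simp only [Finset.mem_inter, Finset.mem_filter, hx, hKT hx, true_and] at this
    exact Bool.eq_iff_iff.2 this
  · intro h hh
    have hu : T.filter (fun x => h x) ∈ 𝒜 :=
      Finset.mem_filter.2 ⟨Finset.mem_powerset.2 (Finset.filter_subset _ _), h, hh, rfl⟩
    refine ⟨_, Finset.mem_image_of_mem g hu, fun x hx => ?_⟩
    have := Finset.ext_iff.1 (hg _ hu) x
    simp only [Finset.mem_filter, hx, true_and] at this
    exact Bool.eq_iff_iff.2 this.symm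

end Combinatorics

/-! ### Concentration and symmetrization, in outer measure. -/

section UniformConvergence

open ProbabilityTheory

/-- A lower bound for the outer product measure of a set, not necessarily measurable, with large
sections. -/
theorem mul_measure_le_prod_of_forall_section {Ω Ω' : Type} [MeasurableSpace Ω]
    [MeasurableSpace Ω'] (μ : Measure Ω) (ν : Measure Ω') [SFinite μ] [SFinite ν]
    (A : Set Ω) (B : Set (Ω × Ω')) (c : ENNReal) (h : ∀ a ∈ A, c ≤ ν {b | (a, b) ∈ B}) :
    c * μ A ≤ (μ.prod ν) B := by
  -- The measurable hull of `B` has the same measure and larger sections; Markov's inequality for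
  -- its section measure finishes.
  set T := toMeasurable (μ.prod ν) B with hT
  have hTm : MeasurableSet T := measurableSet_toMeasurable _ _
  rw [← measure_toMeasurable B, Measure.prod_apply hTm]
  calc c * μ A ≤ c * μ {a | c ≤ ν (Prod.mk a ⁻¹' T)} := by
        gcongr
        intro a ha
        exact (h a ha).trans (measure_mono fun b hb => subset_toMeasurable _ _ hb)
    _ ≤ _ := mul_meas_ge_le_lintegral (measurable_measure_prodMk_left hTm) c

variable {Z : Type} [MeasurableSpace Z]

/-- One-sided Hoeffding bound. The free endpoint `a` lets it serve both a function with values in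
`[0, 1]` and its negative. -/
theorem measureReal_le_sum_sub_integral (P : Measure Z) [IsProbabilityMeasure P] (n : ℕ)
    {f : Z → ℝ} (hf : Measurable f) {a : ℝ} (hfa : ∀ z, f z ∈ Set.Icc a (a + 1)) {t : ℝ}
    (ht : 0 ≤ t) :
    (Measure.pi fun _ : Fin n => P).real {S | t ≤ ∑ i, f (S i) - n * ∫ z, f z ∂P} ≤
      Real.exp (-(2 * t ^ 2 / n)) := by
  have hsub : HasSubgaussianMGF (fun z => f z - ∫ z, f z ∂P) ((‖a + 1 - a‖₊ / 2) ^ 2) P :=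
    hasSubgaussianMGF_of_mem_Icc hf.aemeasurable (ae_of_all _ hfa)
  have hind : iIndepFun (fun (i : Fin n) (S : Fin n → Z) => f (S i) - ∫ z, f z ∂P)
      (Measure.pi fun _ : Fin n => P) :=
    iIndepFun_pi (X := fun _ z => f z - ∫ z, f z ∂P) fun i => (hf.sub_const _).aemeasurable
  have h := HasSubgaussianMGF.measure_sum_ge_le_of_iIndepFun (s := Finset.univ) hind
    (c := fun _ => (‖a + 1 - a‖₊ / 2) ^ 2) (fun i _ => by
      have hmp := measurePreserving_eval (fun _ : Fin n => P) i
      have := hsub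
      rw [← hmp.map_eq] at this
      have h2 := HasSubgaussianMGF.of_map (Y := fun S : Fin n → Z => S i)
        (measurable_pi_apply i).aemeasurable this
      rw [hmp.map_eq] at h2
      exact h2) ht
  simp only [Finset.sum_sub_distrib, Finset.sum_const, Finset.card_univ, Fintype.card_fin,
    nsmul_eq_mul] at h
  refine h.trans (le_of_eq ?_)
  congr 1
  simp
  ring

/-- Hoeffding's inequality for independent copies of a function with values in `[0, 1]`. -/
theorem measure_le_abs_sum_sub_integral (P : Measure Z) [IsProbabilityMeasure P] (n : ℕ)
    {f : Z → ℝ} (hf : Measurable f) (hf01 : ∀ z, f z ∈ Set.Icc (0 : ℝ) 1) {t : ℝ} (ht : 0 ≤ t) :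
    (Measure.pi fun _ : Fin n => P) {S | t ≤ |∑ i, f (S i) - n * ∫ z, f z ∂P|} ≤
      ENNReal.ofReal (2 * Real.exp (-(2 * t ^ 2 / n))) := by
  have h1 := measureReal_le_sum_sub_integral P n hf (a := 0) (by simpa using hf01) ht
  have h2 := measureReal_le_sum_sub_integral P n hf.neg (a := -1)
    (fun z => by have := hf01 z; simp only [Set.mem_Icc, Pi.neg_apply] at this ⊢
                 constructor <;> linarith) ht
  rw [← ofReal_measureReal]
  refine ENNReal.ofReal_le_ofReal ?_
  calc _ ≤ (Measure.pi fun _ : Fin n => P).real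
        ({S | t ≤ ∑ i, f (S i) - n * ∫ z, f z ∂P} ∪
          {S | t ≤ ∑ i, (-f) (S i) - n * ∫ z, (-f) z ∂P}) := by
        refine measureReal_mono fun S hS => ?_
        rcases le_abs.1 (show t ≤ _ from hS) with h | h
        · exact Or.inl h
        · refine Or.inr ?_
          simp only [Set.mem_ofPred_eq, Pi.neg_apply, Finset.sum_neg_distrib, integral_neg]
          linarith
    _ ≤ _ := measureReal_union_le _ _
    _ ≤ _ := by linarith

/-- Hoeffding's inequality for Rademacher sums, as a count of signs. -/
theorem card_le_rademacher_sum {n : ℕ} (hn : 0 < n) (a : Fin n → ℝ) (ha : ∀ i, |a i| ≤ 1)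
    (t : ℝ) (ht : 0 ≤ t) :
    ((Finset.univ.filter fun σ : Fin n → Bool => t ≤ ∑ i, if σ i then a i else -a i).card : ℝ) ≤
      2 ^ n * Real.exp (-(t ^ 2 / (2 * n))) := by
  have hn' : (0 : ℝ) < n := by exact_mod_cast hn
  -- The minimizer of the Chernoff exponent `-l * t + n * l ^ 2 / 2`.
  set l : ℝ := t / n with hl
  have hl0 : 0 ≤ l := by positivity
  have h1 : ((Finset.univ.filter fun σ : Fin n → Bool =>
      t ≤ ∑ i, if σ i then a i else -a i).card : ℝ) ≤
      ∑ σ : Fin n → Bool, Real.exp (-(l * t)) * ∏ i, Real.exp (l * if σ i then a i else -a i) := by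
    rw [Finset.card_eq_sum_ones, Nat.cast_sum]
    refine (Finset.sum_le_sum fun σ hσ => ?_).trans (Finset.sum_le_sum_of_subset_of_nonneg
      (Finset.filter_subset _ _) fun σ _ _ => by positivity)
    have hσ := (Finset.mem_filter.1 hσ).2
    rw [← Real.exp_sum, ← Real.exp_add, ← Finset.mul_sum, Nat.cast_one, Real.one_le_exp_iff]
    nlinarith
  have h2 : ∑ σ : Fin n → Bool, ∏ i, Real.exp (l * if σ i then a i else -a i) =
      ∏ i, ∑ b : Bool, Real.exp (l * if b then a i else -a i) := by
    rw [Finset.prod_univ_sum, Fintype.piFinset_univ]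
  have h3 : ∀ i, ∑ b : Bool, Real.exp (l * if b then a i else -a i) ≤
      2 * Real.exp (l ^ 2 / 2) := by
    intro i
    have hc := Real.cosh_le_exp_half_sq (l * a i)
    rw [Real.cosh_eq] at hc
    have hs : (l * a i) ^ 2 ≤ l ^ 2 := by
      rw [mul_pow]
      have : a i ^ 2 ≤ 1 := (sq_le_one_iff_abs_le_one _).2 (ha i)
      nlinarith [sq_nonneg l]
    have : Real.exp ((l * a i) ^ 2 / 2) ≤ Real.exp (l ^ 2 / 2) := Real.exp_le_exp.2 (by linarith)
    simp only [Fintype.sum_bool, if_true, Bool.false_eq_true, if_false, mul_neg]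
    linarith
  rw [← Finset.mul_sum, h2] at h1
  refine h1.trans ?_
  calc _ ≤ Real.exp (-(l * t)) * ∏ _i : Fin n, (2 * Real.exp (l ^ 2 / 2)) := by
        gcongr with i
        exact h3 i
    _ = 2 ^ n * (Real.exp (-(l * t)) * Real.exp (n * (l ^ 2 / 2))) := by
        rw [Finset.prod_const, Finset.card_univ, Fintype.card_fin, mul_pow, ← Real.exp_nat_mul]
        ring
    _ = _ := by
        rw [← Real.exp_add]
        congr 2
        rw [hl]
        field_simp
        ring

theorem card_le_abs_rademacher_sum {n : ℕ} (hn : 0 < n) (a : Fin n → ℝ) (ha : ∀ i, |a i| ≤ 1)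
    (t : ℝ) (ht : 0 ≤ t) :
    ((Finset.univ.filter fun σ : Fin n → Bool => t ≤ |∑ i, if σ i then a i else -a i|).card : ℝ) ≤
      2 * (2 ^ n * Real.exp (-(t ^ 2 / (2 * n)))) := by
  have h1 := card_le_rademacher_sum hn a ha t ht
  have h2 := card_le_rademacher_sum hn (fun i => -a i) (by simpa using ha) t ht
  have h3 : (Finset.univ.filter fun σ : Fin n → Bool => t ≤ |∑ i, if σ i then a i else -a i|) ⊆
      (Finset.univ.filter fun σ : Fin n → Bool => t ≤ ∑ i, if σ i then a i else -a i) ∪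
      (Finset.univ.filter fun σ : Fin n → Bool => t ≤ ∑ i, if σ i then -a i else - -a i) := by
    intro σ hσ
    simp only [Finset.mem_union, Finset.mem_filter, Finset.mem_univ, true_and] at hσ ⊢
    rcases le_abs.1 hσ with h | h
    · exact Or.inl h
    · refine Or.inr (h.trans (le_of_eq ?_))
      rw [← Finset.sum_neg_distrib]
      refine Finset.sum_congr rfl fun i _ => ?_
      split_ifs <;> rfl
  have h4 : ((_ : ℕ) : ℝ) ≤ ((_ : ℕ) : ℝ) :=
    Nat.cast_le.2 ((Finset.card_le_card h3).trans (Finset.card_union_le _ _))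
  push_cast at h4
  linarith

/-- If averaging over a finite family of measure preserving maps sends all points to `B` at most
`c` times, then `B` has measure at most `c` over the size of the family. -/
theorem card_mul_measure_le_of_measurePreserving {Ω κ : Type} [MeasurableSpace Ω] [Fintype κ]
    (Q : Measure Ω) [IsProbabilityMeasure Q] (φ : κ → Ω → Ω)
    (hφ : ∀ σ, MeasurePreserving (φ σ) Q Q) {B : Set Ω} (hB : MeasurableSet B) (c : ENNReal)
    [∀ W, DecidablePred fun σ => φ σ W ∈ B]
    (hc : ∀ W, ((Finset.univ.filter fun σ => φ σ W ∈ B).card : ENNReal) ≤ c) :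
    Fintype.card κ * Q B ≤ c := by
  calc Fintype.card κ * Q B = ∑ σ : κ, Q (φ σ ⁻¹' B) := by
        simp [fun σ => (hφ σ).measure_preimage hB.nullMeasurableSet]
    _ = ∑ σ : κ, ∫⁻ W, (φ σ ⁻¹' B).indicator 1 W ∂Q := by
        refine Finset.sum_congr rfl fun σ _ => ?_
        rw [lintegral_indicator_one ((hφ σ).measurable hB)]
    _ = ∫⁻ W, ∑ σ : κ, (φ σ ⁻¹' B).indicator 1 W ∂Q := by
        rw [lintegral_finsetSum]
        exact fun σ _ => measurable_one.indicator ((hφ σ).measurable hB)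
    _ ≤ ∫⁻ _, c ∂Q := by
        refine lintegral_mono fun W => (le_of_eq ?_).trans (hc W)
        rw [Finset.card_filter, Nat.cast_sum]
        refine Finset.sum_congr rfl fun σ _ => ?_
        by_cases h : φ σ W ∈ B <;> simp [h]
    _ = c := by simp

variable {ι : Type}

/-- `R` represents the family `f` on the set `T`. -/
def Represents (f : ι → Z → ℝ) (R : Set ι) (T : Finset Z) : Prop :=
  ∀ i, ∃ i' ∈ R, ∀ z ∈ T, f i z = f i' z

/-- The event depends on the family only through its traces on the finitely many sampled points, so
the union over `ι` reduces to one over the countable `I`. -/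
theorem measurableSet_exists_le_abs_sum_sub {f : ι → Z → ℝ} (hf : ∀ i, Measurable (f i))
    {I : Set ι} (hI : I.Countable) (hIf : ∀ T, Represents f I T) (n : ℕ) (t : ℝ) :
    MeasurableSet {W : Fin n → Z × Z | ∃ i, t ≤ |∑ j, (f i (W j).1 - f i (W j).2)|} := by
  classical
  have : {W : Fin n → Z × Z | ∃ i, t ≤ |∑ j, (f i (W j).1 - f i (W j).2)|} =
      ⋃ i ∈ I, {W | t ≤ |∑ j, (f i (W j).1 - f i (W j).2)|} := by
    ext W
    simp only [Set.mem_ofPred_eq, Set.mem_iUnion, exists_prop]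
    refine ⟨fun ⟨i, hi⟩ => ?_, fun ⟨i, _, hi⟩ => ⟨i, hi⟩⟩
    obtain ⟨i', hi', h⟩ := hIf (Finset.univ.image (fun j => (W j).1) ∪
      Finset.univ.image (fun j => (W j).2)) i
    refine ⟨i', hi', hi.trans (le_of_eq ?_)⟩
    congr 1
    refine Finset.sum_congr rfl fun j _ => ?_
    rw [h _ (Finset.mem_union_left _ (Finset.mem_image_of_mem _ (Finset.mem_univ j))),
      h _ (Finset.mem_union_right _ (Finset.mem_image_of_mem _ (Finset.mem_univ j)))]
  rw [this]
  refine MeasurableSet.biUnion hI fun i _ => ?_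
  refine measurableSet_le measurable_const ?_
  have := hf i
  fun_prop

/-- Uniform deviation between two independent samples, for a family with few traces. -/
theorem measure_exists_le_abs_sum_sub_le (P : Measure Z) [IsProbabilityMeasure P]
    {f : ι → Z → ℝ} (hf : ∀ i, Measurable (f i)) (hf01 : ∀ i z, f i z ∈ Set.Icc (0 : ℝ) 1)
    {I : Set ι} (hI : I.Countable) (hIf : ∀ T, Represents f I T) {n : ℕ} (hn : 0 < n) (G : ℕ)
    (hG : ∀ T : Finset Z, T.card ≤ 2 * n → ∃ R : Finset ι, R.card ≤ G ∧ Represents f R T)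
    {t : ℝ} (ht : 0 ≤ t) :
    (Measure.pi fun _ : Fin n => P.prod P)
        {W | ∃ i, t ≤ |∑ j, (f i (W j).1 - f i (W j).2)|} ≤
      ENNReal.ofReal (2 * G * Real.exp (-(t ^ 2 / (2 * n)))) := by
  classical
  set B := {W : Fin n → Z × Z | ∃ i, t ≤ |∑ j, (f i (W j).1 - f i (W j).2)|} with hB
  have hBm : MeasurableSet B := measurableSet_exists_le_abs_sum_sub hf hI hIf n t
  -- Swapping the two samples in any set of coordinates preserves the measure, so it suffices to
  -- count, for a fixed `W`, the sign patterns that land in `B`.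
  let φ : (Fin n → Bool) → (Fin n → Z × Z) → Fin n → Z × Z :=
    fun σ W j => (if σ j then id else Prod.swap) (W j)
  have hφ : ∀ σ, MeasurePreserving (φ σ) (Measure.pi fun _ : Fin n => P.prod P)
      (Measure.pi fun _ : Fin n => P.prod P) := fun σ =>
    measurePreserving_pi _ _ fun j => by
      cases σ j
      · exact Measure.measurePreserving_swap
      · exact MeasurePreserving.id _
  have hcount : ∀ W, ((Finset.univ.filter fun σ => φ σ W ∈ B).card : ℝ) ≤
      2 ^ n * (2 * G * Real.exp (-(t ^ 2 / (2 * n)))) := by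
    intro W
    obtain ⟨R, hRG, hR⟩ := hG (Finset.univ.image (fun j => (W j).1) ∪
      Finset.univ.image (fun j => (W j).2)) (by
        refine (Finset.card_union_le _ _).trans ?_
        have h1 := Finset.card_image_le (s := Finset.univ) (f := fun j => (W j).1)
        have h2 := Finset.card_image_le (s := Finset.univ) (f := fun j => (W j).2)
        simp only [Finset.card_univ, Fintype.card_fin] at h1 h2
        omega)
    have hsub : (Finset.univ.filter fun σ => φ σ W ∈ B) ⊆ R.biUnion fun i =>
        Finset.univ.filter fun σ : Fin n → Bool =>
          t ≤ |∑ j, if σ j then f i (W j).1 - f i (W j).2 else -(f i (W j).1 - f i (W j).2)| := by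
      intro σ hσ
      obtain ⟨i, hi⟩ := (Finset.mem_filter.1 hσ).2
      obtain ⟨i', hi', h⟩ := hR i
      refine Finset.mem_biUnion.2 ⟨i', hi', Finset.mem_filter.2 ⟨Finset.mem_univ _,
        hi.trans (le_of_eq ?_)⟩⟩
      congr 1
      refine Finset.sum_congr rfl fun j _ => ?_
      rw [← h _ (Finset.mem_union_left _ (Finset.mem_image_of_mem _ (Finset.mem_univ j))),
        ← h _ (Finset.mem_union_right _ (Finset.mem_image_of_mem _ (Finset.mem_univ j)))]
      simp only [φ]
      split_ifs <;> simp
    calc ((Finset.univ.filter fun σ => φ σ W ∈ B).card : ℝ)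
        ≤ ∑ i ∈ R, ((Finset.univ.filter fun σ : Fin n → Bool => t ≤ |∑ j, if σ j then
            f i (W j).1 - f i (W j).2 else -(f i (W j).1 - f i (W j).2)|).card : ℝ) := by
          exact_mod_cast (Finset.card_le_card hsub).trans Finset.card_biUnion_le
      _ ≤ ∑ _i ∈ R, 2 * (2 ^ n * Real.exp (-(t ^ 2 / (2 * n)))) := by
          refine Finset.sum_le_sum fun i _ => card_le_abs_rademacher_sum hn _ (fun j => ?_) t ht
          have h1 := hf01 i (W j).1
          have h2 := hf01 i (W j).2
          simp only [Set.mem_Icc] at h1 h2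
          rw [abs_le]
          constructor <;> linarith
      _ = R.card * (2 * (2 ^ n * Real.exp (-(t ^ 2 / (2 * n))))) := by
          rw [Finset.sum_const, nsmul_eq_mul]
      _ ≤ G * (2 * (2 ^ n * Real.exp (-(t ^ 2 / (2 * n))))) := by gcongr
      _ = _ := by ring
  have h := card_mul_measure_le_of_measurePreserving _ φ hφ hBm
    (ENNReal.ofReal (2 ^ n * (2 * G * Real.exp (-(t ^ 2 / (2 * n)))))) fun W => by
      rw [← ENNReal.ofReal_natCast]
      exact ENNReal.ofReal_le_ofReal (hcount W)
  rw [ENNReal.ofReal_mul (by positivity)] at h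
  have hc : ((Fintype.card (Fin n → Bool) : ℕ) : ENNReal) = ENNReal.ofReal (2 ^ n) := by
    rw [← ENNReal.ofReal_natCast]; simp
  rw [hc] at h
  exact (ENNReal.mul_le_mul_iff_right (by simp) ENNReal.ofReal_ne_top).1 h

/-- Uniform convergence, in outer measure, for a family with few traces. -/
theorem measure_exists_lt_abs_sum_sub_integral_le (P : Measure Z) [IsProbabilityMeasure P]
    {f : ι → Z → ℝ} (hf : ∀ i, Measurable (f i)) (hf01 : ∀ i z, f i z ∈ Set.Icc (0 : ℝ) 1)
    {I : Set ι} (hI : I.Countable) (hIf : ∀ T, Represents f I T) {n : ℕ} (hn : 0 < n) (G : ℕ)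
    (hG : ∀ T : Finset Z, T.card ≤ 2 * n → ∃ R : Finset ι, R.card ≤ G ∧ Represents f R T)
    {t : ℝ} (ht : 0 ≤ t) (htn : 3 * n ≤ t ^ 2) :
    (Measure.pi fun _ : Fin n => P)
        {S | ∃ i, 2 * t ≤ |∑ j, f i (S j) - n * ∫ z, f i z ∂P|} ≤
      ENNReal.ofReal (4 * G * Real.exp (-(t ^ 2 / (2 * n)))) := by
  have hn' : (0 : ℝ) < n := by exact_mod_cast hn
  set A := {S : Fin n → Z | ∃ i, 2 * t ≤ |∑ j, f i (S j) - n * ∫ z, f i z ∂P|} with hA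
  set μ := Measure.pi fun _ : Fin n => P with hμ
  set B := {W : Fin n → Z × Z | ∃ i, t ≤ |∑ j, (f i (W j).1 - f i (W j).2)|} with hB
  set B' := {W : (Fin n → Z) × (Fin n → Z) | ∃ i, t ≤ |∑ j, f i (W.1 j) - ∑ j, f i (W.2 j)|}
    with hB'
  have hBB : (μ.prod μ) B' = (Measure.pi fun _ : Fin n => P.prod P) B := by
    have hmp := measurePreserving_arrowProdEquivProdArrow Z Z (Fin n) (fun _ => P) (fun _ => P)
    rw [← hmp.measure_preimage_equiv]
    congr 1
    ext W
    simp [hB', hB, MeasurableEquiv.arrowProdEquivProdArrow, Equiv.arrowProdEquivProdArrow]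
  -- Ghost sample: if `S` deviates by `2 * t` for some `i`, an independent `S'` deviates by less
  -- than `t` for that `i` with probability at least one half, and then the two samples differ by at
  -- least `t`.
  have hhalf : ∀ S ∈ A, ENNReal.ofReal (1 / 2) ≤ μ {S' | (S, S') ∈ B'} := by
    rintro S ⟨i, hi⟩
    have hh := measure_le_abs_sum_sub_integral P n (hf i) (hf01 i) ht
    have hexp : 2 * Real.exp (-(2 * t ^ 2 / n)) ≤ 1 / 2 := by
      have h6 : 6 ≤ 2 * t ^ 2 / n := by
        rw [le_div_iff₀ hn']; linarith
      have h7 : Real.exp (-(2 * t ^ 2 / n)) ≤ Real.exp (-6) := Real.exp_le_exp.2 (by linarith)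
      have h8 : (7 : ℝ) ≤ Real.exp 6 := by
        have := Real.add_one_le_exp (6 : ℝ); linarith
      have h9 : (Real.exp 6)⁻¹ ≤ 7⁻¹ := inv_anti₀ (by norm_num) h8
      rw [← Real.exp_neg] at h9
      linarith
    have hm : MeasurableSet {S' : Fin n → Z | t ≤ |∑ i_1, f i (S' i_1) - n * ∫ z, f i z ∂P|} := by
      refine measurableSet_le measurable_const ?_
      have := hf i
      fun_prop
    have hsub : {S' : Fin n → Z | t ≤ |∑ i_1, f i (S' i_1) - n * ∫ z, f i z ∂P|}ᶜ ⊆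
        {S' | (S, S') ∈ B'} := by
      intro S' hS'
      simp only [Set.mem_compl_iff, Set.mem_ofPred_eq, not_le] at hS'
      refine ⟨i, ?_⟩
      have h3 := abs_sub_abs_le_abs_sub (∑ j, f i (S j) - n * ∫ z, f i z ∂P)
        (∑ j, f i (S' j) - n * ∫ z, f i z ∂P)
      rw [sub_sub_sub_cancel_right] at h3
      linarith
    refine le_trans ?_ (measure_mono hsub)
    rw [prob_compl_eq_one_sub hm]
    refine le_trans ?_ (tsub_le_tsub_left (hh.trans (ENNReal.ofReal_le_ofReal hexp)) 1)
    rw [← ENNReal.ofReal_one, ← ENNReal.ofReal_sub _ (by norm_num)]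
    exact ENNReal.ofReal_le_ofReal (by norm_num)
  have h1 := mul_measure_le_prod_of_forall_section μ μ A B' _ hhalf
  rw [hBB] at h1
  have h2 := h1.trans (measure_exists_le_abs_sum_sub_le P hf hf01 hI hIf hn G hG ht)
  calc μ A = ENNReal.ofReal 2 * (ENNReal.ofReal (1 / 2) * μ A) := by
        rw [← mul_assoc, ← ENNReal.ofReal_mul (by norm_num)]; norm_num
    _ ≤ ENNReal.ofReal 2 * ENNReal.ofReal (2 * G * Real.exp (-(t ^ 2 / (2 * n)))) := by gcongr
    _ = _ := by
        rw [← ENNReal.ofReal_mul (by norm_num)]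
        congr 1; ring

end UniformConvergence

/-! ### Pointwise relations between adversarial and margin loss. -/

section Losses

variable {X : Type}

theorem advLoss_eq_zero_or_one (U : Pert X) (h : Hyp X) (x : X) (y : Bool) :
    advLoss U h x y = 0 ∨ advLoss U h x y = 1 := by
  unfold advLoss
  split_ifs <;> simp

theorem advLoss_mem_Icc (U : Pert X) (h : Hyp X) (x : X) (y : Bool) :
    advLoss U h x y ∈ Set.Icc (0 : ℝ) 1 := by
  rcases advLoss_eq_zero_or_one U h x y with h | h <;> simp [h]

theorem advLoss_eq_one_iff {U : Pert X} {h : Hyp X} {x : X} {y : Bool} :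
    advLoss U h x y = 1 ↔ ∃ z ∈ U x, h z ≠ y := by
  unfold advLoss
  split_ifs with hh <;> simp [hh]

theorem marginLoss_eq_zero_or_one (U : Pert X) (h : Hyp X) (x : X) :
    marginLoss U h x = 0 ∨ marginLoss U h x = 1 := by
  unfold marginLoss
  split_ifs <;> simp

theorem marginLoss_eq_zero_iff {U : Pert X} {h : Hyp X} {x : X} :
    marginLoss U h x = 0 ↔ ∀ z ∈ U x, ∀ z' ∈ U x, h z = h z' := by
  unfold marginLoss
  split_ifs with hh
  · simp only [one_ne_zero, false_iff]
    push Not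
    exact hh
  · push Not at hh
    simpa using hh

theorem advLoss_congr {U : Pert X} {h h' : Hyp X} {x : X} (hh : ∀ z ∈ U x, h z = h' z)
    (y : Bool) : advLoss U h x y = advLoss U h' x y := by
  have : (∃ z ∈ U x, h z ≠ y) ↔ ∃ z ∈ U x, h' z ≠ y :=
    exists_congr fun z => and_congr_right fun hz => by rw [hh z hz]
  classical
  exact if_congr this rfl rfl

theorem marginLoss_le_advLoss (U : Pert X) (h : Hyp X) (x : X) (y : Bool) :
    marginLoss U h x ≤ advLoss U h x y := by
  rcases advLoss_eq_zero_or_one U h x y with h0 | h1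
  · rw [h0]
    refine le_of_eq (marginLoss_eq_zero_iff.2 fun z hz z' hz' => ?_)
    have : ¬ ∃ z ∈ U x, h z ≠ y := fun hh => by
      rw [advLoss_eq_one_iff.2 hh] at h0; exact one_ne_zero h0
    push Not at this
    rw [this z hz, this z' hz']
  · rw [h1]
    rcases marginLoss_eq_zero_or_one U h x with h | h <;> simp [h]

/-- If `h` and `h'` do not robustly differ at `x`, an error of `h'` at `x` is either a margin error
of `h'` or an error of `h`. -/
theorem advLoss_le_add_of_not_differ {U : Pert X} {h h' : Hyp X} {x : X} (y : Bool)
    (hh : ¬ (marginLoss U h x = 0 ∧ marginLoss U h' x = 0 ∧ ∃ z ∈ U x, h z ≠ h' z)) :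
    advLoss U h' x y ≤ marginLoss U h' x + advLoss U h x y := by
  have hn := (advLoss_mem_Icc U h x y).1
  have h1 := (advLoss_mem_Icc U h' x y).2
  rcases marginLoss_eq_zero_or_one U h' x with hm' | hm'
  · rw [hm', zero_add]
    rcases marginLoss_eq_zero_or_one U h x with hm | hm
    · refine le_of_eq (advLoss_congr (fun z hz => ?_) y)
      by_contra hne
      exact hh ⟨hm, hm', z, hz, Ne.symm hne⟩
    · have := marginLoss_le_advLoss U h x y
      linarith
  · rw [hm']; linarith

theorem empMarginRisk_le_empAdvRisk (U : Pert X) {n : ℕ} (S : LSample X n) (h : Hyp X) :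
    empMarginRisk U (fun i => (S i).1) h ≤ empAdvRisk U S h := by
  unfold empMarginRisk empAdvRisk
  gcongr with i
  exact marginLoss_le_advLoss _ _ _ _

theorem empAdvRisk_le_add_of_not_robustlyDiffer {U : Pert X} {n : ℕ} (S : LSample X n)
    {h h' : Hyp X} (hh : ¬ RobustlyDiffer U (fun i => (S i).1) h h') :
    empAdvRisk U S h' ≤ empMarginRisk U (fun i => (S i).1) h' + empAdvRisk U S h := by
  unfold empMarginRisk empAdvRisk
  rw [← add_div, ← Finset.sum_add_distrib]
  gcongr with i
  exact advLoss_le_add_of_not_differ _ fun hd => hh ⟨i, hd⟩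

theorem advRisk_nonneg [MeasurableSpace X] (U : Pert X) (P : Measure (X × Bool)) (h : Hyp X) :
    0 ≤ advRisk U P h := measureReal_nonneg

theorem advApproxError_nonneg [MeasurableSpace X] (U : Pert X) (P : Measure (X × Bool))
    (H : Set (Hyp X)) : 0 ≤ advApproxError U P H :=
  Real.sInf_nonneg (by rintro _ ⟨h, -, rfl⟩; exact advRisk_nonneg U P h)

theorem advRisk_le_of_imp [MeasurableSpace X] {U V : Pert X} (P : Measure (X × Bool))
    [IsFiniteMeasure P] {h h' : Hyp X}
    (hh : ∀ x y, (∃ z ∈ U x, h z ≠ y) → ∃ z ∈ V x, h' z ≠ y) :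
    advRisk U P h ≤ advRisk V P h' :=
  measureReal_mono fun p hp => advLoss_eq_one_iff.2 (hh p.1 p.2 (advLoss_eq_one_iff.1 hp))

end Losses

/-! ### Risks for the discretized perturbation sets. -/

section Discretization

variable {X : Type} [PseudoMetricSpace X] {C : Set X} {ρ : ℝ}

theorem advRisk_discPert_le_ballPert [MeasurableSpace X] (P : Measure (X × Bool))
    [IsFiniteMeasure P] (h : Hyp X) : advRisk (discPert C ρ) P h ≤ advRisk (ballPert ρ) P h :=
  advRisk_le_of_imp P fun _ _ ⟨z, hz, hh⟩ => ⟨z, hz.1, hh⟩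

/-- A point `z` within `r` of `x` has its nearest neighbour within `r * γ` of `z`, hence within `(1
+ γ) * r` of `x`; an error at `z` is thus an error of `h` on the discretized set of `x`. -/
theorem advRisk_comp_nearest_le [MeasurableSpace X] (P : Measure (X × Bool)) [IsFiniteMeasure P]
    {r γ : ℝ} {nn : X → X} (hC : IsCover C (r * γ)) (hnn : IsNearest C nn) (h : Hyp X) :
    advRisk (ballPert r) P (fun x => h (nn x)) ≤ advRisk (discPert C ((1 + γ) * r)) P h := by
  refine advRisk_le_of_imp P fun x y ⟨z, hz, hh⟩ => ⟨nn z, ⟨?_, (hnn z).1⟩, hh⟩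
  obtain ⟨c, hc, hzc⟩ := hC z
  have h1 := (hnn z).2 c hc
  have h2 : dist z x ≤ r := hz
  have h3 := dist_triangle_left (nn z) x z
  show dist (nn z) x ≤ _
  linarith

theorem discPert_nonempty {r γ : ℝ} (hr : 0 < r) (hC : IsCover C (r * γ)) (x : X) :
    (discPert C ((1 + γ) * r) x).Nonempty := by
  obtain ⟨c, hc, hxc⟩ := hC x
  refine ⟨c, ?_, hc⟩
  show dist c x ≤ _
  rw [dist_comm]
  linarith

/-- Every point of `C` lies in the finite discretized set of some point of a countable dense set. -/
theorem countable_of_encard_discPert_le [TopologicalSpace.SeparableSpace X] (hρ : 0 < ρ) {k : ℕ}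
    (hk : ∀ x, (discPert C ρ x).encard ≤ k) : C.Countable := by
  obtain ⟨s, hs, hsd⟩ := TopologicalSpace.exists_countable_dense X
  refine (hs.biUnion (t := fun x _ => discPert C ρ x) fun x _ => ?_).mono fun c hc => ?_
  · exact (Set.finite_of_encard_le_coe (hk x)).countable
  · obtain ⟨x, hxs, hx⟩ := hsd.exists_dist_lt c hρ
    exact Set.mem_biUnion hxs ⟨hx.le, hc⟩

variable [MeasurableSpace X] [OpensMeasurableSpace X]

/-- Exchanging centre and perturbation writes the loss set as a countable union, over `z ∈ C`, of
closed balls times sets of labels; no measurability of `h` is needed. -/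
theorem measurable_advLoss_discPert (hC : C.Countable) (h : Hyp X) :
    Measurable fun p : X × Bool => advLoss (discPert C ρ) h p.1 p.2 := by
  classical
  have hset : {p : X × Bool | ∃ z ∈ discPert C ρ p.1, h z ≠ p.2} =
      ⋃ z ∈ C, {p | p.1 ∈ Metric.closedBall z ρ ∧ h z ≠ p.2} := by
    ext p
    simp only [discPert, Set.mem_inter_iff, Set.mem_ofPred_eq, Set.mem_iUnion, exists_prop,
      Metric.mem_closedBall]
    refine exists_congr fun z => ?_
    rw [dist_comm p.1 z]
    tauto
  have hm : MeasurableSet {p : X × Bool | ∃ z ∈ discPert C ρ p.1, h z ≠ p.2} := by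
    rw [hset]
    refine MeasurableSet.biUnion hC fun z _ => MeasurableSet.inter ?_ ?_
    · exact measurable_fst Metric.isClosed_closedBall.measurableSet
    · exact measurable_snd (t := {y | h z ≠ y}) (Set.toFinite _).measurableSet
  exact Measurable.ite hm measurable_const measurable_const

theorem integral_advLoss_discPert (hC : C.Countable) (h : Hyp X) (P : Measure (X × Bool)) :
    ∫ p, advLoss (discPert C ρ) h p.1 p.2 ∂P = advRisk (discPert C ρ) P h := by
  have hm : MeasurableSet {p : X × Bool | advLoss (discPert C ρ) h p.1 p.2 = 1} :=
    measurable_advLoss_discPert hC h (measurableSet_singleton 1)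
  rw [advRisk, ← integral_indicator_one hm]
  congr 1
  ext p
  rcases advLoss_eq_zero_or_one (discPert C ρ) h p.1 p.2 with h0 | h1
  · rw [Set.indicator_of_notMem (by simp [h0]), h0]
  · rw [Set.indicator_of_mem (by simpa using h1), h1]; rfl

/-- Uniform convergence of the discretized adversarial risk over a VC class. -/
theorem measure_exists_le_abs_empAdvRisk_sub_advRisk (hC : C.Countable) {k : ℕ}
    (hk : ∀ x, (discPert C ρ x).encard ≤ k) {H : Set (Hyp X)} (hH : classVCDim H < ⊤)
    (P : Measure (X × Bool)) [IsProbabilityMeasure P] {n : ℕ} (hn : 0 < n) {ε : ℝ} (hε : 0 ≤ ε)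
    (hnε : 12 ≤ n * ε ^ 2) :
    (Measure.pi fun _ : Fin n => P)
        {S | ∃ h ∈ H, ε ≤ |empAdvRisk (discPert C ρ) S h - advRisk (discPert C ρ) P h|} ≤
      ENNReal.ofReal (4 * (2 * n * k + 1) ^ (classVCDim H).toNat *
        Real.exp (-(n * ε ^ 2 / 8))) := by
  classical
  have hn' : (0 : ℝ) < n := by exact_mod_cast hn
  set U := discPert C ρ with hU
  let f : H → X × Bool → ℝ := fun h p => advLoss U h p.1 p.2
  have hfin : ∀ x, (U x).Finite := fun x => Set.finite_of_encard_le_coe (hk x)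
  -- The losses on `T` are determined by the values of `h` on these at most `T.card * k` points of
  -- `C`.
  let pts : Finset (X × Bool) → Finset X := fun T => T.biUnion fun p => (hfin p.1).toFinset
  have hpts : ∀ T : Finset (X × Bool), (pts T).card ≤ T.card * k := fun T => by
    refine Finset.card_biUnion_le_card_mul _ _ _ fun p _ => ?_
    have := hk p.1
    rw [(hfin p.1).encard_eq_coe_toFinset_card] at this
    exact_mod_cast this
  have hptsC : ∀ T, ↑(pts T) ⊆ C := fun T x hx => by
    obtain ⟨p, -, hp⟩ := Finset.mem_biUnion.1 (Finset.mem_coe.1 hx)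
    exact ((hfin p.1).mem_toFinset.1 hp).2
  have hrep : ∀ T : Finset X, ∃ R : Finset H, R.card ≤ (T.card + 1) ^ (classVCDim H).toNat ∧
      ∀ h : H, ∃ h' ∈ R, ∀ x ∈ T, (h : Hyp X) x = (h' : Hyp X) x := by
    intro T
    obtain ⟨R, hRH, hRc, hR⟩ := exists_representatives hH T
    refine ⟨R.subtype (· ∈ H), (Finset.card_subtype _ _).le.trans
      ((Finset.card_filter_le _ _).trans hRc), fun h => ?_⟩
    obtain ⟨h', hh', he⟩ := hR h h.2
    exact ⟨⟨h', hRH hh'⟩, Finset.mem_subtype.2 hh', he⟩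
  choose R hRc hR using hrep
  have hRpts : ∀ T, Represents f (R (pts T)) T := by
    intro T h
    obtain ⟨h', hh', he⟩ := hR (pts T) h
    exact ⟨h', hh', fun p hp => advLoss_congr (fun z hz => he z (Finset.mem_biUnion.2
      ⟨p, hp, (hfin p.1).mem_toFinset.2 hz⟩)) _⟩
  -- Representatives for all finite subsets of the countable `C` form the countable subfamily needed
  -- for measurability.
  have hCfin : {T : Finset X | ↑T ⊆ C}.Countable := by
    have := hC.to_subtype
    refine (Set.countable_range fun T : Finset C => T.map (Function.Embedding.subtype _)).mono ?_
    exact fun T hT => ⟨T.subtype (· ∈ C), Finset.subtype_map_of_mem fun x hx => hT hx⟩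
  have hI : (⋃ T ∈ {T : Finset X | ↑T ⊆ C}, (R T : Set H)).Countable :=
    hCfin.biUnion fun T _ => (R T).countable_toSet
  have key := measure_exists_lt_abs_sum_sub_integral_le P (f := f)
    (fun h => measurable_advLoss_discPert hC h) (fun h p => advLoss_mem_Icc _ _ _ _) hI
    (fun T h => by
      obtain ⟨h', hh', he⟩ := hRpts T h
      exact ⟨h', Set.mem_biUnion (hptsC T) hh', he⟩) hn
    ((2 * n * k + 1) ^ (classVCDim H).toNat)
    (fun T hT => ⟨R (pts T), (hRc _).trans (Nat.pow_le_pow_left (Nat.add_le_add_right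
      ((hpts T).trans (Nat.mul_le_mul_right _ hT)) 1) _), hRpts T⟩)
    (t := n * ε / 2) (by positivity) (by nlinarith)
  refine le_trans (measure_mono ?_) (key.trans (le_of_eq ?_))
  · rintro S ⟨h, hh, hS⟩
    refine ⟨⟨h, hh⟩, ?_⟩
    simp only [f, hU, integral_advLoss_discPert hC]
    rw [← hU]
    have : ∑ j, advLoss U h (S j).1 (S j).2 - n * advRisk U P h =
        n * (empAdvRisk U S h - advRisk U P h) := by
      unfold empAdvRisk
      field_simp
    rw [this, abs_mul, abs_of_pos hn']
    nlinarith
  · congr 1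
    push_cast
    congr 2
    field_simp
    ring

/-- Hoeffding's inequality and the union bound for the discretized adversarial risk over a finite
class. -/
theorem measure_exists_mem_finset_le_abs_empAdvRisk_sub_advRisk (hC : C.Countable)
    (G : Finset (Hyp X)) (P : Measure (X × Bool)) [IsProbabilityMeasure P] {m : ℕ} (hm : 0 < m)
    {ε : ℝ} (hε : 0 ≤ ε) :
    (Measure.pi fun _ : Fin m => P)
        {S | ∃ h ∈ G, ε ≤ |empAdvRisk (discPert C ρ) S h - advRisk (discPert C ρ) P h|} ≤
      ENNReal.ofReal (G.card * (2 * Real.exp (-(2 * m * ε ^ 2)))) := by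
  have hm' : (0 : ℝ) < m := by exact_mod_cast hm
  set U := discPert C ρ with hU
  have hset : {S : LSample X m | ∃ h ∈ G, ε ≤ |empAdvRisk U S h - advRisk U P h|} =
      ⋃ h ∈ G, {S | ε ≤ |empAdvRisk U S h - advRisk U P h|} := by
    ext S; simp
  rw [hset]
  refine (measure_biUnion_finset_le _ _).trans ?_
  rw [ENNReal.ofReal_mul (by positivity), ENNReal.ofReal_natCast, ← nsmul_eq_mul]
  refine Finset.sum_le_card_nsmul _ _ _ fun h _ => ?_
  have key := measure_le_abs_sum_sub_integral P m (measurable_advLoss_discPert (ρ := ρ) hC h)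
    (fun p => advLoss_mem_Icc _ _ _ _) (t := m * ε) (by positivity)
  rw [integral_advLoss_discPert hC] at key
  refine le_trans (measure_mono ?_) (key.trans (le_of_eq ?_))
  · intro S hS
    have : ∑ j, advLoss U h (S j).1 (S j).2 - m * advRisk U P h =
        m * (empAdvRisk U S h - advRisk U P h) := by
      unfold empAdvRisk
      field_simp
    simp only [Set.mem_ofPred_eq] at hS ⊢
    rw [this, abs_mul, abs_of_pos hm']
    gcongr
  · congr 3
    field_simp

end Discretization

/-! ### The pruned class: its quality and its size. -/

section Pruning

variable {X : Type}

theorem RobustlyDiffer.symm {U : Pert X} {n : ℕ} {xs : Fin n → X} {h h' : Hyp X}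
    (hd : RobustlyDiffer U xs h h') : RobustlyDiffer U xs h' h := by
  obtain ⟨i, h1, h2, z, hz, hne⟩ := hd
  exact ⟨i, h2, h1, z, hz, hne.symm⟩

theorem not_robustlyDiffer_self (U : Pert X) {n : ℕ} (xs : Fin n → X) (h : Hyp X) :
    ¬ RobustlyDiffer U xs h h := by
  rintro ⟨i, -, -, z, -, hne⟩
  exact hne rfl

-- Loop invariant, by induction from the end of the list. A rejected hypothesis is witnessed by one
-- kept earlier, whose margin risk is no larger because the list is sorted.
open Classical in
theorem foldl_prune_spec (U : Pert X) {n : ℕ} (xs : Fin n → X) (l : List (Hyp X))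
    (hl : l.Pairwise fun h h' => empMarginRisk U xs h ≤ empMarginRisk U xs h') :
    let G := l.foldl (fun kept h =>
      if ∀ h' ∈ kept, RobustlyDiffer U xs h h' then insert h kept else kept) (∅ : Finset (Hyp X))
    (∀ h ∈ G, h ∈ l) ∧ (∀ h ∈ G, ∀ h' ∈ G, h ≠ h' → RobustlyDiffer U xs h h') ∧
      ∀ h ∈ l, ∃ h' ∈ G, empMarginRisk U xs h' ≤ empMarginRisk U xs h ∧
        ¬ RobustlyDiffer U xs h h' := by
  induction l using List.reverseRecOn with
  | nil => simp
  | append_singleton l a ih =>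
    rw [List.pairwise_append] at hl
    obtain ⟨hl, -, hla⟩ := hl
    obtain ⟨hG, hdiff, hex⟩ := ih hl
    simp only [List.foldl_append, List.foldl_cons, List.foldl_nil]
    set G := l.foldl (fun kept h =>
      if ∀ h' ∈ kept, RobustlyDiffer U xs h h' then insert h kept else kept) (∅ : Finset (Hyp X))
    split_ifs with hcond
    · refine ⟨fun h hh => ?_, fun h hh h' hh' hne => ?_, fun h hh => ?_⟩
      · rcases Finset.mem_insert.1 hh with rfl | hh
        · simp
        · exact List.mem_append_left _ (hG h hh)
      · rcases Finset.mem_insert.1 hh with e | hG <;>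
          rcases Finset.mem_insert.1 hh' with e' | hG'
        · exact absurd (e.trans e'.symm) hne
        · exact e ▸ hcond h' hG'
        · exact e' ▸ (hcond h hG).symm
        · exact hdiff h hG h' hG' hne
      · rcases List.mem_append.1 hh with hh | hh
        · obtain ⟨h', hh', hle⟩ := hex h hh
          exact ⟨h', Finset.mem_insert_of_mem hh', hle⟩
        · rw [List.mem_singleton.1 hh]
          exact ⟨a, Finset.mem_insert_self _ _, le_rfl, not_robustlyDiffer_self U xs a⟩
    · refine ⟨fun h hh => List.mem_append_left _ (hG h hh), hdiff, fun h hh => ?_⟩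
      rcases List.mem_append.1 hh with hh | hh
      · exact hex h hh
      · rw [List.mem_singleton.1 hh]
        push Not at hcond
        obtain ⟨h', hh', hnd⟩ := hcond
        exact ⟨h', hh', hla h' (hG h' hh') a (by simp), hnd⟩

theorem exists_empMarginRisk_eq (U : Pert X) {n : ℕ} (xs : Fin n → X) (h : Hyp X) :
    ∃ s ∈ List.range (n + 1), empMarginRisk U xs h = (s : ℝ) / n := by
  classical
  refine ⟨(Finset.univ.filter fun i => marginLoss U h (xs i) = 1).card, ?_, ?_⟩
  · rw [List.mem_range, Nat.lt_succ_iff]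
    simpa using Finset.card_filter_le (Finset.univ : Finset (Fin n))
      fun i => marginLoss U h (xs i) = 1
  · unfold empMarginRisk
    congr 1
    rw [Finset.card_filter, Nat.cast_sum]
    refine Finset.sum_congr rfl fun i _ => ?_
    rcases marginLoss_eq_zero_or_one U h (xs i) with h | h <;> simp [h]

-- In `visitOrder` the index runs over reals, through a monadic coercion of the list of naturals;
-- this form replaces the coercion by a map.
open Classical in
theorem visitOrder_eq (U : Pert X) (enum : Finset (Hyp X) → List (Hyp X)) {n : ℕ}
    (xs : Fin n → X) (G : Finset (Hyp X)) :
    visitOrder U enum xs G = ((List.range (n + 1)).map (Nat.cast : ℕ → ℝ)).flatMap fun s =>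
      (enum G).filter fun h => decide (empMarginRisk U xs h = s / n) := by
  unfold visitOrder
  congr 1
  exact List.flatMap_pure_eq_map _ _

theorem mem_visitOrder {U : Pert X} {enum : Finset (Hyp X) → List (Hyp X)}
    (henum : IsEnumeration enum) {n : ℕ} {xs : Fin n → X} {G : Finset (Hyp X)} {h : Hyp X} :
    h ∈ visitOrder U enum xs G ↔ h ∈ G := by
  have hmem : h ∈ enum G ↔ h ∈ G := by
    rw [← Finset.mem_val, ← henum G, Multiset.mem_coe]
  rw [visitOrder_eq]
  simp only [List.mem_flatMap, List.mem_filter, decide_eq_true_eq, hmem]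
  refine ⟨fun ⟨s, _, hh, _⟩ => hh, fun hh => ?_⟩
  obtain ⟨s, hs, he⟩ := exists_empMarginRisk_eq U xs h
  exact ⟨s, List.mem_map_of_mem hs, hh, he⟩

theorem pairwise_visitOrder (U : Pert X) (enum : Finset (Hyp X) → List (Hyp X)) {n : ℕ}
    (xs : Fin n → X) (G : Finset (Hyp X)) :
    (visitOrder U enum xs G).Pairwise fun h h' => empMarginRisk U xs h ≤ empMarginRisk U xs h' := by
  rw [visitOrder_eq, List.pairwise_flatMap, List.pairwise_map]
  refine ⟨fun s _ => ?_, List.pairwise_lt_range.imp fun {s s'} hss h hh h' hh' => ?_⟩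
  · refine List.Pairwise.imp_of_mem (R := fun _ _ => True) ?_ (List.pairwise_of_forall
      fun _ _ => trivial)
    intro h h' hh hh' _
    simp only [List.mem_filter, decide_eq_true_eq] at hh hh'
    rw [hh.2, hh'.2]
  · simp only [List.mem_filter, decide_eq_true_eq] at hh hh'
    rw [hh.2, hh'.2]
    gcongr

theorem prunedClass_spec (U : Pert X) {enum : Finset (Hyp X) → List (Hyp X)}
    (henum : IsEnumeration enum) {n : ℕ} (xs : Fin n → X) (G : Finset (Hyp X)) :
    prunedClass U enum xs G ⊆ G ∧
      (∀ h ∈ prunedClass U enum xs G, ∀ h' ∈ prunedClass U enum xs G, h ≠ h' →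
        RobustlyDiffer U xs h h') ∧
      ∀ h ∈ G, ∃ h' ∈ prunedClass U enum xs G,
        empMarginRisk U xs h' ≤ empMarginRisk U xs h ∧ ¬ RobustlyDiffer U xs h h' := by
  obtain ⟨h1, h2, h3⟩ := foldl_prune_spec U xs _ (pairwise_visitOrder U enum xs G)
  exact ⟨fun h hh => (mem_visitOrder henum).1 (h1 h hh), h2,
    fun h hh => h3 h ((mem_visitOrder henum).2 hh)⟩

theorem mem_candidates {A : Rule X} {n : ℕ} {xs : Fin n → X} {h : Hyp X} :
    h ∈ candidates A xs ↔ ∃ y : Fin n → Bool, A n (fun i => (xs i, y i)) = h := by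
  simp [candidates]

theorem candidates_subset {U : Pert X} {H : Set (Hyp X)} {A : Rule X} (hA : IsRERM U H A) {n : ℕ}
    (xs : Fin n → X) : ↑(candidates A xs) ⊆ H := by
  intro h hh
  obtain ⟨y, rfl⟩ := mem_candidates.1 hh
  exact (hA n _).1

theorem prunedClass_candidates_subset {U : Pert X} {H : Set (Hyp X)} {A : Rule X}
    (hA : IsRERM U H A) {enum : Finset (Hyp X) → List (Hyp X)} (henum : IsEnumeration enum)
    {n : ℕ} (xs : Fin n → X) : ↑(prunedClass U enum xs (candidates A xs)) ⊆ H := fun _ hh =>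
  candidates_subset hA xs ((prunedClass_spec U henum xs _).1 hh)

/-- For every labeling of the unlabeled sample, the pruned class contains a hypothesis whose
empirical adversarial risk is at most twice the optimal one. -/
theorem exists_mem_prunedClass_empAdvRisk_le {U : Pert X} {H : Set (Hyp X)} {A : Rule X}
    (hA : IsRERM U H A) {enum : Finset (Hyp X) → List (Hyp X)} (henum : IsEnumeration enum)
    {n : ℕ} (S : LSample X n) :
    ∃ h' ∈ prunedClass U enum (fun i => (S i).1) (candidates A fun i => (S i).1),
      ∀ h ∈ H, empAdvRisk U S h' ≤ 2 * empAdvRisk U S h := by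
  obtain ⟨h', hh', hle, hnd⟩ := (prunedClass_spec U henum (fun i => (S i).1)
    (candidates A fun i => (S i).1)).2.2 (A n S)
      (mem_candidates.2 ⟨fun i => (S i).2, rfl⟩)
  refine ⟨h', hh', fun h hh => ?_⟩
  have h1 := empAdvRisk_le_add_of_not_robustlyDiffer S hnd
  have h2 := empMarginRisk_le_empAdvRisk U S (A n S)
  have h3 := (hA n S).2 h hh
  linarith

theorem prunedClass_candidates_nonempty (U : Pert X) (A : Rule X)
    {enum : Finset (Hyp X) → List (Hyp X)} (henum : IsEnumeration enum)
    {n : ℕ} (xs : Fin n → X) : (prunedClass U enum xs (candidates A xs)).Nonempty := by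
  obtain ⟨h', hh', -⟩ := (prunedClass_spec U henum xs (candidates A xs)).2.2
    (A n fun i => (xs i, true)) (mem_candidates.2 ⟨fun _ => true, rfl⟩)
  exact ⟨h', hh'⟩

/-- A finite class of hypotheses that pairwise robustly differ on `n` points is small. -/
theorem card_le_of_pairwise_robustlyDiffer {U : Pert X} (hU : ∀ x, (U x).Nonempty)
    {H : Set (Hyp X)} (hH : robustVCDim U H < ⊤) {n : ℕ} (xs : Fin n → X) {F : Finset (Hyp X)}
    (hFH : ↑F ⊆ H) (hF : ∀ h ∈ F, ∀ h' ∈ F, h ≠ h' → RobustlyDiffer U xs h h') :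
    F.card ≤ (n + 1) ^ (Nat.log 2 ((n + 1) ^ (robustVCDim U H).toNat) + 1) := by
  classical
  choose c hc using hU
  -- The robust label, undefined where `h` is not robust; shattering by these partial labelings is
  -- robust shattering.
  let v : Hyp X → X → Option Bool := fun h x => if marginLoss U h x = 0 then some (h (c x)) else none
  have hv : ∀ {h x b}, v h x = some b → ∀ z ∈ U x, h z = b := by
    intro h x b hb z hz
    simp only [v] at hb
    split_ifs at hb with hm
    rw [← Option.some_inj.1 hb]
    exact marginLoss_eq_zero_iff.1 hm z hz _ (hc x)
  set T := Finset.univ.image xs with hT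
  have hTc : T.card ≤ n := by
    simpa using Finset.card_image_le (s := Finset.univ) (f := xs)
  have hpair : PairwiseOpposite v F T := by
    intro h hh h' hh' hne
    obtain ⟨i, h1, h2, z, hz, hzne⟩ := hF h hh h' hh' hne
    refine ⟨xs i, Finset.mem_image_of_mem _ (Finset.mem_univ i), h (c (xs i)), by simp [v, h1], ?_⟩
    have e1 := marginLoss_eq_zero_iff.1 h1 z hz _ (hc (xs i))
    have e2 := marginLoss_eq_zero_iff.1 h2 z hz _ (hc (xs i))
    rw [e1, e2] at hzne
    simp only [v, h2, if_true, Option.some_inj]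
    exact Bool.eq_not.2 (Ne.symm hzne)
  have hcount : (partialShatterer v F T).card ≤ (n + 1) ^ (robustVCDim U H).toNat := by
    refine le_trans (Finset.card_le_card fun K hK => ?_) ((card_filter_powerset_le T
      (robustVCDim U H).toNat).trans (Nat.pow_le_pow_left (by omega) _))
    obtain ⟨hKT, hK⟩ := Finset.mem_filter.1 hK
    refine Finset.mem_filter.2 ⟨hKT, card_le_robustVCDim hH fun y => ?_⟩
    obtain ⟨h, hh, hy⟩ := hK y
    exact ⟨h, hFH hh, fun x hx => hv (hy x hx)⟩
  refine (card_le_of_pairwiseOpposite v T F _ hpair (hcount.trans_lt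
    (Nat.lt_pow_succ_log_self one_lt_two _))).trans (Nat.pow_le_pow_left (by omega) _)

/-- Two hypotheses with different robust labels at a point robustly shatter it. -/
theorem card_le_one_of_robustVCDim_eq_zero {U : Pert X} {H : Set (Hyp X)}
    (hH : robustVCDim U H = 0) {n : ℕ} (xs : Fin n → X) {F : Finset (Hyp X)} (hFH : ↑F ⊆ H)
    (hF : ∀ h ∈ F, ∀ h' ∈ F, h ≠ h' → RobustlyDiffer U xs h h') : F.card ≤ 1 := by
  refine Finset.card_le_one.2 fun h hh h' hh' => by_contra fun hne => ?_
  obtain ⟨i, h1, h2, z, hz, hzne⟩ := hF h hh h' hh' hne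
  have hs : RobustlyShatters U H {xs i} := by
    intro y
    rcases Bool.eq_or_eq_not (y (xs i)) (h z) with he | he
    · refine ⟨h, hFH hh, fun x hx w hw => ?_⟩
      rw [Finset.mem_singleton.1 hx] at hw ⊢
      rw [he]
      exact marginLoss_eq_zero_iff.1 h1 _ hw _ hz
    · refine ⟨h', hFH hh', fun x hx w hw => ?_⟩
      rw [Finset.mem_singleton.1 hx] at hw ⊢
      rw [he, marginLoss_eq_zero_iff.1 h2 _ hw _ hz]
      exact Bool.eq_not.2 (Ne.symm hzne)
  have := card_le_robustVCDim (by simp [hH]) hs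
  simp [hH] at this

theorem subsingleton_of_classVCDim_eq_zero {H : Set (Hyp X)} (hH : classVCDim H = 0) :
    H.Subsingleton := by
  intro h hh h' hh'
  by_contra hne
  obtain ⟨x, hx⟩ := Function.ne_iff.1 hne
  have hs : ClassShatters H {x} := by
    intro y
    rcases Bool.eq_or_eq_not (y x) (h x) with he | he
    · exact ⟨h, hh, fun z hz => by rw [Finset.mem_singleton.1 hz, he]⟩
    · refine ⟨h', hh', fun z hz => ?_⟩
      rw [Finset.mem_singleton.1 hz, he]
      exact Bool.eq_not.2 (Ne.symm hx)
  have := card_le_classVCDim (by simp [hH]) hs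
  simp [hH] at this

end Pruning

/-! ### Success probability, given the deviation bounds. -/

section Guarantee

theorem ofReal_one_sub_le_measure {Ω : Type} [MeasurableSpace Ω] (μ : Measure Ω)
    [IsProbabilityMeasure μ] {A B : Set Ω} {δ : ℝ} (hδ : 0 ≤ δ) (hAB : ∀ x, x ∉ B → x ∈ A)
    (hB : μ B ≤ ENNReal.ofReal δ) : ENNReal.ofReal (1 - δ) ≤ μ A := by
  rw [ENNReal.ofReal_sub _ hδ, ENNReal.ofReal_one, tsub_le_iff_right]
  calc 1 = μ Set.univ := measure_univ.symm
    _ ≤ μ (A ∪ B) := measure_mono fun x _ => by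
        by_cases h : x ∈ B
        · exact Or.inr h
        · exact Or.inl (hAB x h)
    _ ≤ μ A + μ B := measure_union_le _ _
    _ ≤ _ := by gcongr

variable {X : Type} [PseudoMetricSpace X] [MeasurableSpace X] [OpensMeasurableSpace X]
  {C : Set X} {ρ : ℝ}

/-- With enough unlabeled points, the pruned class contains a good hypothesis. -/
theorem ofReal_le_measure_exists_mem_prunedClass (hC : C.Countable) {k : ℕ}
    (hk : ∀ x, (discPert C ρ x).encard ≤ k) {H : Set (Hyp X)} (hH : classVCDim H < ⊤)
    {A : Rule X} (hA : IsRERM (discPert C ρ) H A) {enum : Finset (Hyp X) → List (Hyp X)}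
    (henum : IsEnumeration enum) (P : Measure (X × Bool)) [IsProbabilityMeasure P] {n : ℕ}
    {ε δ : ℝ} (hε : 0 < ε) (hδ : 0 < δ)
    (hn : H.Subsingleton ∨ 0 < n ∧ 768 ≤ n * ε ^ 2 ∧
      4 * (2 * n * k + 1) ^ (classVCDim H).toNat * Real.exp (-(n * ε ^ 2 / 512)) ≤ δ / 2) :
    ENNReal.ofReal (1 - δ / 2) ≤ (Measure.pi fun _ : Fin n => P.map Prod.fst)
      {xs | ∃ h' ∈ prunedClass (discPert C ρ) enum xs (candidates A xs), ∀ h ∈ H,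
        advRisk (discPert C ρ) P h' ≤ 2 * advRisk (discPert C ρ) P h + 3 * ε / 8} := by
  set U := discPert C ρ with hU
  have : IsProbabilityMeasure (P.map Prod.fst) :=
    Measure.isProbabilityMeasure_map measurable_fst.aemeasurable
  rcases hn with hs | ⟨hn, hnε, hnδ⟩
  · refine ofReal_one_sub_le_measure _ (B := ∅) (by positivity) (fun xs _ => ?_) (by simp)
    obtain ⟨h', hh'⟩ := prunedClass_candidates_nonempty U A henum xs
    refine ⟨h', hh', fun h hh => ?_⟩
    rw [hs (prunedClass_candidates_subset hA henum xs hh') hh]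
    have := advRisk_nonneg U P h
    linarith
  -- The unlabeled sample is viewed as the projection of a labeled one, whose labels serve only the
  -- analysis.
  · rw [← Measure.pi_map_pi fun _ => measurable_fst.aemeasurable]
    refine le_trans ?_ (Measure.le_map_apply (measurable_pi_lambda _ fun i =>
      measurable_fst.comp (measurable_pi_apply i)).aemeasurable _)
    have hdev := measure_exists_le_abs_empAdvRisk_sub_advRisk hC hk hH P hn (ε := ε / 8)
      (by positivity) (by linarith [show (n : ℝ) * (ε / 8) ^ 2 = n * ε ^ 2 / 64 by ring])
    refine ofReal_one_sub_le_measure _ (by positivity) (fun S hS => ?_)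
      (hdev.trans (ENNReal.ofReal_le_ofReal ?_))
    · obtain ⟨h', hh', hle⟩ := exists_mem_prunedClass_empAdvRisk_le hA henum S
      refine ⟨h', hh', fun h hh => ?_⟩
      simp only [Set.mem_ofPred_eq, not_exists, not_and, not_le] at hS
      have h1 := abs_lt.1 (hS h' (prunedClass_candidates_subset hA henum _ hh'))
      have h2 := abs_lt.1 (hS h hh)
      have h3 := hle h hh
      rw [← hU] at h1 h2
      linarith [h1.1, h2.2]
    · convert hnδ using 4
      ring

/-- With enough labeled points, empirical minimization over a finite class is nearly optimal. -/
theorem ofReal_le_measure_advRisk_rerm_le (hC : C.Countable) {G : Finset (Hyp X)} {B : Rule X}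
    (hB : IsRERM (discPert C ρ) ↑G B) (P : Measure (X × Bool)) [IsProbabilityMeasure P] {m : ℕ}
    {ε δ : ℝ} (hε : 0 < ε) (hδ : 0 < δ)
    (hm : G.card ≤ 1 ∨ 0 < m ∧ G.card * (2 * Real.exp (-(m * ε ^ 2 / 32))) ≤ δ / 2) :
    ENNReal.ofReal (1 - δ / 2) ≤ (Measure.pi fun _ : Fin m => P)
      {S | ∀ h ∈ G, advRisk (discPert C ρ) P (B m S) ≤ advRisk (discPert C ρ) P h + ε / 4} := by
  set U := discPert C ρ with hU
  rcases hm with h1 | ⟨hm, hmδ⟩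
  · refine ofReal_one_sub_le_measure _ (B := ∅) (by positivity) (fun S _ h hh => ?_) (by simp)
    rw [Finset.card_le_one.1 h1 _ (hB m S).1 h hh]
    linarith
  · have hdev := measure_exists_mem_finset_le_abs_empAdvRisk_sub_advRisk (ρ := ρ) hC G P hm
      (ε := ε / 8) (by positivity)
    refine ofReal_one_sub_le_measure _ (by positivity) (fun S hS h hh => ?_)
      (hdev.trans (ENNReal.ofReal_le_ofReal ?_))
    · simp only [Set.mem_ofPred_eq, not_exists, not_and, not_le] at hS
      have h1 := abs_lt.1 (hS _ (hB m S).1)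
      have h2 := abs_lt.1 (hS h hh)
      have h3 := (hB m S).2 h hh
      rw [← hU] at h1 h2
      linarith [h1.1, h2.2]
    · convert hmδ using 4
      ring

/-- The pruned learner succeeds once both samples are large enough for the two deviation bounds. -/
theorem tolerantlyLearns_prunedLearner {r γ : ℝ} (hC : C.Countable) (hcov : IsCover C (r * γ))
    {k : ℕ} (hk : ∀ x, (discPert C ((1 + γ) * r) x).encard ≤ k) {H : Set (Hyp X)}
    (hHne : H.Nonempty) (hH : classVCDim H < ⊤) {A : Rule X}
    {B : Finset (Hyp X) → Rule X} {enum : Finset (Hyp X) → List (Hyp X)} {nn : X → X}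
    (hA : IsRERM (discPert C ((1 + γ) * r)) H A)
    (hB : ∀ G : Finset (Hyp X), G.Nonempty → IsRERM (discPert C ((1 + γ) * r)) ↑G (B G))
    (henum : IsEnumeration enum) (hnn : IsNearest C nn) {mu : ℝ → ℝ → ℕ} {ml : ℕ → ℝ → ℝ → ℕ}
    (hmu : ∀ ε ∈ Set.Ioo (0 : ℝ) 1, ∀ δ ∈ Set.Ioo (0 : ℝ) 1, ∀ n, mu ε δ ≤ n →
      H.Subsingleton ∨ 0 < n ∧ 768 ≤ n * ε ^ 2 ∧
        4 * (2 * n * k + 1) ^ (classVCDim H).toNat * Real.exp (-(n * ε ^ 2 / 512)) ≤ δ / 2)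
    (hml : ∀ ε ∈ Set.Ioo (0 : ℝ) 1, ∀ δ ∈ Set.Ioo (0 : ℝ) 1, ∀ n, mu ε δ ≤ n → ∀ m, ml n ε δ ≤ m →
      ∀ xs : Fin n → X, ∀ G : Finset (Hyp X), ↑G ⊆ H →
        (∀ h ∈ G, ∀ h' ∈ G, h ≠ h' → RobustlyDiffer (discPert C ((1 + γ) * r)) xs h h') →
        G.card ≤ 1 ∨ 0 < m ∧ G.card * (2 * Real.exp (-(m * ε ^ 2 / 32))) ≤ δ / 2) :
    TolerantlyLearns 3 (ballPert r) (ballPert ((1 + γ) * r)) H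
      (prunedLearner (discPert C ((1 + γ) * r)) A B enum nn) mu ml := by
  intro P hP ε hε δ hδ n hn m hm
  set U := discPert C ((1 + γ) * r) with hU
  have : IsProbabilityMeasure (P.map Prod.fst) :=
    Measure.isProbabilityMeasure_map measurable_fst.aemeasurable
  set μ := Measure.pi fun _ : Fin n => P.map Prod.fst with hμ
  set ν := Measure.pi fun _ : Fin m => P with hν
  set good := {S : LSample X m × (Fin n → X) | advRisk (ballPert r) P
    (prunedLearner U A B enum nn m n S.1 S.2) ≤
      3 * advApproxError (ballPert ((1 + γ) * r)) P H + ε} with hgood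
  have hu := ofReal_le_measure_exists_mem_prunedClass hC hk hH hA henum P hε.1 hδ.1
    (hmu ε hε δ hδ n hn)
  -- Once `xs` is fixed, the pruned class is a fixed finite class, independent of the labeled
  -- sample.
  have hsec : ∀ xs ∈ {xs : Fin n → X | ∃ h' ∈ prunedClass U enum xs (candidates A xs), ∀ h ∈ H,
        advRisk U P h' ≤ 2 * advRisk U P h + 3 * ε / 8},
      ENNReal.ofReal (1 - δ / 2) ≤ ν {S | (xs, S) ∈ Prod.swap ⁻¹' good} := by
    rintro xs ⟨h', hh', hle⟩
    obtain ⟨-, hdiff, -⟩ := prunedClass_spec U henum xs (candidates A xs)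
    refine (ofReal_le_measure_advRisk_rerm_le hC
      (hB _ (prunedClass_candidates_nonempty U A henum xs)) P hε.1 hδ.1
      (hml ε hε δ hδ n hn m hm xs _ (prunedClass_candidates_subset hA henum xs) hdiff)).trans
      (measure_mono fun S hS => ?_)
    have h1 := hS h' hh'
    have h2 := advRisk_comp_nearest_le P hcov hnn
      (B (prunedClass U enum xs (candidates A xs)) m S)
    have h3 : (advRisk U P h' - 3 * ε / 8) / 2 ≤ advApproxError (ballPert ((1 + γ) * r)) P H := by
      refine le_csInf (hHne.image _) ?_
      rintro _ ⟨h, hh, rfl⟩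
      have h4 := hle h hh
      have h5 : advRisk U P h ≤ advRisk (ballPert ((1 + γ) * r)) P h :=
        advRisk_discPert_le_ballPert P h
      linarith
    have h6 := advApproxError_nonneg (ballPert ((1 + γ) * r)) P H
    have hε0 := hε.1
    show advRisk (ballPert r) P
      (fun x => B (prunedClass U enum xs (candidates A xs)) m S (nn x)) ≤ _
    rw [← hU] at h1 h2
    -- The errors add up to `3 * ε / 8 + ε / 4 < ε` above twice the optimum; nonnegativity of the
    -- optimum allows the factor 3.
    linarith
  have hprod := mul_measure_le_prod_of_forall_section μ ν _ _ _ hsec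
  have hswap : (μ.prod ν) (Prod.swap ⁻¹' good) = (ν.prod μ) good :=
    (Measure.measurePreserving_swap (μ := μ) (ν := ν)).measure_preimage_equiv
      (f := MeasurableEquiv.prodComm) good
  rw [hswap] at hprod
  refine le_trans ?_ (le_trans (mul_le_mul_right hu _) hprod)
  have hδ0 := hδ.1
  have hδ1 := hδ.2
  rw [← ENNReal.ofReal_mul (by linarith)]
  -- Both stages succeed with probability at least `(1 - δ / 2) ^ 2 ≥ 1 - δ`.
  exact ENNReal.ofReal_le_ofReal (by nlinarith)

end Guarantee

/-! ### Solving the deviation bounds for the sample sizes. -/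

section SampleSizes

theorem one_le_log_two_add {f : ℝ} (hf : 1 ≤ f) : 1 ≤ Real.log (2 + f) := by
  rw [Real.le_log_iff_exp_le (by linarith)]
  have := Real.exp_one_lt_d9
  linarith

/-- Resolves the implicit sample size bound `n ≥ 512 f (7 + log n)`. -/
theorem mul_add_log_le_of_le {f x : ℝ} (hf : 1 ≤ f) (hx : 14336 * f * Real.log (2 + f) ≤ x) :
    512 * f * (7 + Real.log x) ≤ x := by
  have hL := one_le_log_two_add hf
  have hx0 : 0 < x := lt_of_lt_of_le (by positivity) hx
  -- With slope `1 / (1024 * f)` the logarithm costs only half of `x`; the other half pays for the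
  -- rest, as `14336 = 2 * 512 * 14`.
  have h1 : Real.log (x / (1024 * f)) ≤ x / (1024 * f) - 1 :=
    Real.log_le_sub_one_of_pos (by positivity)
  rw [Real.log_div hx0.ne' (by positivity), Real.log_mul (by norm_num) (by positivity)] at h1
  have h2 : Real.log 1024 ≤ 7 := by
    have : (1024 : ℝ) = 2 ^ 10 := by norm_num
    rw [this, Real.log_pow]
    have := Real.log_two_lt_d9
    push_cast
    linarith
  have h3 : Real.log f ≤ Real.log (2 + f) := Real.log_le_log (by linarith) (by linarith)
  have h4 : 7 + Real.log x ≤ x / (1024 * f) + 14 * Real.log (2 + f) := by linarith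
  calc 512 * f * (7 + Real.log x) ≤ 512 * f * (x / (1024 * f) + 14 * Real.log (2 + f)) := by gcongr
    _ = x / 2 + 14336 * f * Real.log (2 + f) / 2 := by field_simp; ring
    _ ≤ x := by linarith

theorem log_one_div_nonneg {δ : ℝ} (hδ : δ ∈ Set.Ioo (0 : ℝ) 1) : 0 ≤ Real.log (1 / δ) := by
  rw [one_div]
  exact Real.log_nonneg ((one_le_inv₀ hδ.1).2 hδ.2.le)

/-- The deviation bound for the unlabeled sample, from the size of that sample. -/
theorem growth_mul_exp_le {v n k : ℕ} {D ε δ : ℝ} (hv : 1 ≤ v) (hk : 1 ≤ k) (hD : 1 ≤ D)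
    (hkD : Real.log k ≤ 2 * D) (hε : ε ∈ Set.Ioo (0 : ℝ) 1) (hδ : δ ∈ Set.Ioo (0 : ℝ) 1)
    (hn : 14336 * ((v * D + Real.log (1 / δ)) / ε ^ 2) *
      Real.log (2 + (v * D + Real.log (1 / δ)) / ε ^ 2) ≤ n) :
    14336 ≤ n * ε ^ 2 ∧
      4 * (2 * n * k + 1) ^ v * Real.exp (-(n * ε ^ 2 / 512)) ≤ δ / 2 := by
  have hl := log_one_div_nonneg hδ
  have hε0 := hε.1
  have hδ0 := hδ.1
  have hε2 : 0 < ε ^ 2 := by positivity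
  have hε21 : ε ^ 2 ≤ 1 := pow_le_one₀ hε0.le hε.2.le
  have hv' : (1 : ℝ) ≤ v := by exact_mod_cast hv
  have hk' : (1 : ℝ) ≤ k := by exact_mod_cast hk
  have hvD : 1 ≤ v * D := by nlinarith
  set a := v * D + Real.log (1 / δ) with ha
  have ha1 : 1 ≤ a := by linarith
  set f := a / ε ^ 2 with hf
  have haf : a ≤ f := by rw [hf, le_div_iff₀ hε2]; nlinarith
  have hf1 : 1 ≤ f := ha1.trans haf
  have hfε : f * ε ^ 2 = a := by rw [hf]; field_simp
  have hL := one_le_log_two_add hf1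
  have hn1 : 14336 * f ≤ n := by nlinarith
  have hnε : 14336 ≤ n * ε ^ 2 := by nlinarith
  refine ⟨hnε, ?_⟩
  have hn0 : (1 : ℝ) ≤ n := by linarith
  have hlog := mul_add_log_le_of_le hf1 hn
  have hln : 0 ≤ Real.log n := Real.log_nonneg hn0
  have h1 : Real.log (2 * n * k + 1) ≤ 2 + Real.log n + 2 * D := by
    calc Real.log (2 * n * k + 1) ≤ Real.log (3 * n * k) := by
          refine Real.log_le_log (by positivity) ?_
          have : 1 ≤ (n : ℝ) * k := by nlinarith
          linarith
      _ = Real.log 3 + Real.log n + Real.log k := by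
          rw [Real.log_mul (by positivity) (by positivity),
            Real.log_mul (by norm_num) (by positivity)]
      _ ≤ _ := by
          have : Real.log 3 ≤ 3 - 1 := Real.log_le_sub_one_of_pos (by norm_num)
          linarith
  have h8 : Real.log 8 ≤ 3 := by
    have : (8 : ℝ) = 2 ^ 3 := by norm_num
    rw [this, Real.log_pow]
    have := Real.log_two_lt_d9
    push_cast
    linarith
  -- The logarithm of the claim. The 7 is `3 + 4`, from `log 8 ≤ 3` and `2 + log n + 2 * D ≤ D * (4
  -- + log n)`.
  have h2 : Real.log 8 + v * Real.log (2 * n * k + 1) + Real.log (1 / δ) ≤ n * ε ^ 2 / 512 := by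
    have e1 : v * Real.log (2 * n * k + 1) ≤ v * (D * (4 + Real.log n)) := by
      gcongr
      nlinarith
    have e2 : Real.log (1 / δ) ≤ Real.log (1 / δ) * (7 + Real.log n) := by nlinarith
    have e3 : Real.log 8 ≤ (v * D) * 3 := by linarith
    have e4 : a * (7 + Real.log n) ≤ n * ε ^ 2 / 512 := by
      rw [← hfε]; nlinarith
    calc _ ≤ (v * D) * 3 + v * (D * (4 + Real.log n)) + Real.log (1 / δ) * (7 + Real.log n) := by
          linarith
      _ = a * (7 + Real.log n) := by rw [ha]; ring
      _ ≤ _ := e4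
  have h3 : Real.exp (Real.log 8 + v * Real.log (2 * n * k + 1) + Real.log (1 / δ)) =
      8 * (2 * n * k + 1) ^ v * (1 / δ) := by
    rw [Real.exp_add, Real.exp_add, Real.exp_log (by norm_num), Real.exp_nat_mul,
      Real.exp_log (by positivity), Real.exp_log (by positivity)]
  have h4 := Real.exp_le_exp.2 h2
  rw [h3] at h4
  rw [Real.exp_neg, ← div_eq_mul_inv, div_le_iff₀ (Real.exp_pos _)]
  calc 4 * (2 * n * k + 1 : ℝ) ^ v = δ / 2 * (8 * (2 * n * k + 1) ^ v * (1 / δ)) := by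
        field_simp; ring
    _ ≤ _ := by gcongr

/-- The deviation bound for the labeled sample, from the size of that sample. -/
theorem card_mul_exp_le {d n m N : ℕ} {ε δ : ℝ} (hd : 1 ≤ d) (hn : 3 ≤ n)
    (hε : ε ∈ Set.Ioo (0 : ℝ) 1) (hδ : δ ∈ Set.Ioo (0 : ℝ) 1)
    (hN : N ≤ (n + 1) ^ (Nat.log 2 ((n + 1) ^ d) + 1))
    (hm : 224 * ((d * Real.log n + Real.log (1 / δ)) / ε ^ 2) * Real.log (2 + n) ≤ m) :
    N * (2 * Real.exp (-(m * ε ^ 2 / 32))) ≤ δ / 2 := by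
  have hl := log_one_div_nonneg hδ
  have hε0 := hε.1
  have hδ0 := hδ.1
  have hε2 : 0 < ε ^ 2 := by positivity
  have hd' : (1 : ℝ) ≤ d := by exact_mod_cast hd
  have hn' : (3 : ℝ) ≤ n := by exact_mod_cast hn
  have hln : 1 ≤ Real.log n := by
    have h := one_le_log_two_add (le_refl (1 : ℝ))
    have h2 : Real.log (2 + 1) ≤ Real.log n := Real.log_le_log (by norm_num) (by linarith)
    linarith
  have hL : Real.log n ≤ Real.log (2 + n) := Real.log_le_log (by linarith) (by linarith)
  have hL1 : Real.log (n + 1) ≤ Real.log (2 + n) := Real.log_le_log (by linarith) (by linarith)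
  have hL2 : Real.log (n + 1) ≤ 2 * Real.log n := by
    have : 2 * Real.log n = Real.log (n ^ 2 : ℝ) := by rw [Real.log_pow]; norm_num
    rw [this]
    exact Real.log_le_log (by linarith) (by nlinarith)
  have hL0 : 0 ≤ Real.log ((n : ℝ) + 1) := Real.log_nonneg (by linarith)
  set j := Nat.log 2 ((n + 1) ^ d) with hj
  have hj' : (j : ℝ) ≤ 4 * (d * Real.log n) := by
    have h1 : 2 ^ j ≤ (n + 1) ^ d := Nat.pow_log_le_self 2 (by positivity)
    have h2 : (2 : ℝ) ^ j ≤ ((n : ℝ) + 1) ^ d := by exact_mod_cast h1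
    have h3 := Real.log_le_log (by positivity) h2
    rw [Real.log_pow, Real.log_pow] at h3
    have h4 := Real.log_two_gt_d9
    have h5 : (j : ℝ) / 2 ≤ d * Real.log (n + 1) := by
      have : (0 : ℝ) ≤ j := by positivity
      nlinarith
    have h6 : d * Real.log (n + 1) ≤ d * (2 * Real.log n) := by gcongr
    linarith
  set L := Real.log (2 + n) with hLdef
  set u := d * Real.log n with hu
  have hu1 : 1 ≤ u := by nlinarith
  have hlogN : (j + 1 : ℝ) * Real.log (n + 1) ≤ 5 * u * L :=
    mul_le_mul (by linarith) hL1 hL0 (by positivity)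
  have h4 : Real.log 4 ≤ 2 * u * L := by
    have : (4 : ℝ) = 2 ^ 2 := by norm_num
    rw [this, Real.log_pow]
    have := Real.log_two_lt_d9
    push_cast
    nlinarith
  have h5 : Real.log (1 / δ) ≤ 7 * Real.log (1 / δ) * L := by nlinarith
  -- The coefficient is `7 = 2 + 5`, from the first two summands, and `224 = 7 * 32`. The exponent
  -- `j` is itself of order `d * log n`, whence the extra logarithm.
  have h6 : Real.log 4 + (j + 1 : ℝ) * Real.log (n + 1) + Real.log (1 / δ) ≤ m * ε ^ 2 / 32 := by
    calc _ ≤ 7 * (u + Real.log (1 / δ)) * L := by linarith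
      _ = (224 * ((u + Real.log (1 / δ)) / ε ^ 2) * L) * ε ^ 2 / 32 := by field_simp; ring
      _ ≤ _ := by gcongr
  have h7 : Real.exp (Real.log 4 + (j + 1 : ℝ) * Real.log (n + 1) + Real.log (1 / δ)) =
      4 * ((n : ℝ) + 1) ^ (j + 1) * (1 / δ) := by
    rw [Real.exp_add, Real.exp_add, Real.exp_log (by norm_num), Real.exp_log (by positivity)]
    have : (j + 1 : ℝ) = ((j + 1 : ℕ) : ℝ) := by push_cast; ring
    rw [this, Real.exp_nat_mul, Real.exp_log (by positivity)]
  have h8 := Real.exp_le_exp.2 h6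
  rw [h7] at h8
  have hN' : (N : ℝ) ≤ ((n : ℝ) + 1) ^ (j + 1) := by exact_mod_cast hN
  rw [Real.exp_neg, ← mul_assoc, ← div_eq_mul_inv, div_le_iff₀ (Real.exp_pos _)]
  calc (N : ℝ) * 2 ≤ ((n : ℝ) + 1) ^ (j + 1) * 2 := by gcongr
    _ = δ / 2 * (4 * ((n : ℝ) + 1) ^ (j + 1) * (1 / δ)) := by field_simp; ring
    _ ≤ _ := by gcongr

theorem natCeil_le_mul {c K f L : ℝ} (hf : 1 ≤ f) (hL : 1 ≤ L) (hc : 0 ≤ c) (hcK : c + 1 ≤ K) :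
    (⌈c * f * L⌉₊ : ℝ) ≤ K * f * L ^ 1 := by
  have h := (Nat.ceil_lt_add_one (show 0 ≤ c * f * L by positivity)).le
  have hfL : 1 ≤ f * L := by nlinarith
  nlinarith

end SampleSizes

/-! ### The guarantee for a general cover. -/

section Guarantee

variable {X : Type} [PseudoMetricSpace X] [MeasurableSpace X] [OpensMeasurableSpace X]

/-- The guarantee for the pruned learner, for any cover with few points in each perturbation set. -/
theorem prunedGuarantee_of_log_le [TopologicalSpace.SeparableSpace X] [Nonempty X] {r γ : ℝ}
    (hr : 0 < r) (hγ : 0 < γ) {C : Set X} (hcov : IsCover C (r * γ)) {k : ℕ}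
    (hk : ∀ x, (discPert C ((1 + γ) * r) x).encard ≤ k) {H : Set (Hyp X)} (hHne : H.Nonempty)
    (hH : classVCDim H < ⊤) {D : ℝ} (hD : 1 ≤ D) (hkD : Real.log k ≤ 2 * D) :
    PrunedGuarantee 20000 1 r γ C H D := by
  have hρ : 0 < (1 + γ) * r := by positivity
  have hC : C.Countable := countable_of_encard_discPert_le hρ hk
  have hne := discPert_nonempty hr hcov
  have hk1 : 1 ≤ k := by
    obtain ⟨x⟩ := ‹Nonempty X›
    exact_mod_cast (Set.one_le_encard_iff_nonempty.2 (hne x)).trans (hk x)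
  set U := discPert C ((1 + γ) * r) with hU
  have hle : robustVCDim U H ≤ classVCDim H := robustVCDim_le_classVCDim hne
  have hUH : robustVCDim U H < ⊤ := hle.trans_lt hH
  set v := (classVCDim H).toNat with hv
  set d := (robustVCDim U H).toNat with hd
  have hdv : d ≤ v := ENat.toNat_le_toNat hle hH.ne
  have hf0 : ∀ ε δ, δ ∈ Set.Ioo (0 : ℝ) 1 → 0 ≤ unlabeledRate H D ε δ := fun ε δ hδ => by
    have := log_one_div_nonneg hδ
    unfold unlabeledRate
    positivity
  have hg0 : ∀ n ε δ, δ ∈ Set.Ioo (0 : ℝ) 1 → 0 ≤ labeledRate U H n ε δ := fun n ε δ hδ => by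
    have := log_one_div_nonneg hδ
    have := Real.log_natCast_nonneg n
    unfold labeledRate
    positivity
  -- In dimension zero the rate may be too small to pay for rounding up, so the sample size must be
  -- 0 there; otherwise the rate is at least 1.
  let mu : ℝ → ℝ → ℕ := fun ε δ => if v = 0 then 0 else
    ⌈14336 * unlabeledRate H D ε δ * Real.log (2 + unlabeledRate H D ε δ)⌉₊
  let ml : ℕ → ℝ → ℝ → ℕ := fun n ε δ => if d = 0 then 0 else
    ⌈224 * labeledRate U H n ε δ * Real.log (2 + n)⌉₊
  have hmu : v ≠ 0 → ∀ ε ∈ Set.Ioo (0 : ℝ) 1, ∀ δ ∈ Set.Ioo (0 : ℝ) 1, ∀ n, mu ε δ ≤ n →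
      14336 ≤ n * ε ^ 2 ∧ 3 ≤ n ∧
        4 * (2 * n * k + 1) ^ v * Real.exp (-(n * ε ^ 2 / 512)) ≤ δ / 2 := by
    intro hv0 ε hε δ hδ n hn
    simp only [mu, hv0, if_false] at hn
    obtain ⟨h1, h2⟩ := growth_mul_exp_le (Nat.one_le_iff_ne_zero.2 hv0) hk1 hD hkD hε hδ
      (Nat.ceil_le.1 hn)
    refine ⟨h1, ?_, h2⟩
    have h3 : ε ^ 2 ≤ 1 := pow_le_one₀ hε.1.le hε.2.le
    have h4 : (3 : ℝ) ≤ n := by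
      have : (0 : ℝ) ≤ n := by positivity
      nlinarith
    exact_mod_cast h4
  refine ⟨mu, ml, fun ε hε δ hδ => ⟨?_, fun n hn => ?_⟩, ?_⟩
  · by_cases hv0 : v = 0
    · have := hf0 ε δ hδ
      have hlog : 0 ≤ Real.log (2 + unlabeledRate H D ε δ) := Real.log_nonneg (by linarith)
      simp only [mu, hv0, if_true, Nat.cast_zero]
      positivity
    · simp only [mu, hv0, if_false]
      have hf1 : 1 ≤ unlabeledRate H D ε δ := by
        have h1 := log_one_div_nonneg hδ
        have h2 : (1 : ℝ) ≤ v := by exact_mod_cast Nat.one_le_iff_ne_zero.2 hv0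
        have h3 : ε ^ 2 ≤ 1 := pow_le_one₀ hε.1.le hε.2.le
        unfold unlabeledRate
        rw [← hv, le_div_iff₀ (pow_pos hε.1 2)]
        nlinarith
      exact natCeil_le_mul hf1 (one_le_log_two_add hf1) (by norm_num) (by norm_num)
  · by_cases hd0 : d = 0
    · have := hg0 n ε δ hδ
      have hlog : 0 ≤ Real.log (2 + n) :=
        Real.log_nonneg (by linarith [(Nat.cast_nonneg n : (0 : ℝ) ≤ n)])
      simp only [ml, hd0, if_true, Nat.cast_zero]
      positivity
    · obtain ⟨-, hn3, -⟩ := hmu (by omega) ε hε δ hδ n hn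
      have hn' : (3 : ℝ) ≤ n := by exact_mod_cast hn3
      simp only [ml, hd0, if_false]
      have hln : 1 ≤ Real.log n := by
        have h := one_le_log_two_add (le_refl (1 : ℝ))
        have h2 : Real.log (2 + 1) ≤ Real.log n := Real.log_le_log (by norm_num) (by linarith)
        linarith
      have hg1 : 1 ≤ labeledRate U H n ε δ := by
        have h1 := log_one_div_nonneg hδ
        have h2 : (1 : ℝ) ≤ d := by exact_mod_cast Nat.one_le_iff_ne_zero.2 hd0
        have h3 : ε ^ 2 ≤ 1 := pow_le_one₀ hε.1.le hε.2.le
        unfold labeledRate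
        rw [← hd, le_div_iff₀ (pow_pos hε.1 2)]
        nlinarith
      exact natCeil_le_mul hg1 (one_le_log_two_add (by linarith)) (by norm_num) (by norm_num)
  · intro A B enum nn hA hB henum hnn
    refine tolerantlyLearns_prunedLearner hC hcov hk hHne hH hA hB henum hnn
      (fun ε hε δ hδ n hn => ?_) (fun ε hε δ hδ n hn m hm xs G hGH hG => ?_)
    · by_cases hv0 : v = 0
      · left
        refine subsingleton_of_classVCDim_eq_zero ?_
        rw [← ENat.natCast_toNat hH.ne, ← hv, hv0, Nat.cast_zero]
      · obtain ⟨h1, h2, h3⟩ := hmu hv0 ε hε δ hδ n hn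
        exact Or.inr ⟨by omega, by linarith, h3⟩
    · by_cases hd0 : d = 0
      · left
        refine card_le_one_of_robustVCDim_eq_zero (U := U) ?_ xs hGH hG
        rw [← ENat.natCast_toNat hUH.ne, ← hd, hd0, Nat.cast_zero]
      · right
        obtain ⟨-, hn3, -⟩ := hmu (by omega) ε hε δ hδ n hn
        simp only [ml, hd0, if_false] at hm
        have hcard := card_le_of_pairwise_robustlyDiffer hne hUH xs hGH hG
        refine ⟨?_, card_mul_exp_le (Nat.one_le_iff_ne_zero.2 hd0) hn3 hε hδ hcard
          (Nat.ceil_le.1 hm)⟩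
        refine lt_of_lt_of_le (Nat.ceil_pos.2 ?_) hm
        have hn' : (3 : ℝ) ≤ n := by exact_mod_cast hn3
        have h1 := log_one_div_nonneg hδ
        have h2 : (1 : ℝ) ≤ d := by exact_mod_cast Nat.one_le_iff_ne_zero.2 hd0
        have h3 : 0 < Real.log n := Real.log_pos (by linarith)
        have h4 : 0 < Real.log (2 + n) := Real.log_pos (by linarith)
        have h5 := hε.1
        have h6 : 0 < labeledRate U H n ε δ := by
          unfold labeledRate
          rw [← hd]
          positivity
        positivity

end Guarantee

/-! ### Covering radius and local size of a grid. -/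

section Grid

variable {d : ℕ} {q : ENNReal} [Fact (1 ≤ q)]

/-- Every `ℓ_q` norm on `ℝ^d` is at most `d` times the largest coordinate. -/
theorem piLp_norm_le_of_forall_abs_le (x : PiLp q fun _ : Fin d => ℝ) {a : ℝ}
    (hx : ∀ i, |x i| ≤ a) : ‖x‖ ≤ d * a := by
  have hsum : x = ∑ i, PiLp.single q i (x i) := by
    ext j
    simp [WithLp.ofLp_sum]
  calc ‖x‖ = ‖∑ i, PiLp.single q i (x i)‖ := by rw [← hsum]
    _ ≤ ∑ i, ‖PiLp.single q (β := fun _ : Fin d => ℝ) i (x i)‖ := norm_sum_le _ _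
    _ ≤ ∑ _i : Fin d, a := by
        refine Finset.sum_le_sum fun i _ => ?_
        rw [PiLp.norm_single, Real.norm_eq_abs]
        exact hx i
    _ = d * a := by simp

theorem isCover_grid {s : ℝ} (hs : 0 < s) (b : Fin d → ℝ) :
    IsCover (grid d q s b) (d * (s / 2)) := by
  intro x
  refine ⟨WithLp.toLp q fun i => b i + s * round ((x i - b i) / s),
    fun i => ⟨round ((x i - b i) / s), rfl⟩, ?_⟩
  rw [dist_eq_norm]
  refine piLp_norm_le_of_forall_abs_le _ fun i => ?_
  have h := abs_sub_round ((x i - b i) / s)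
  have e : (x - WithLp.toLp q fun i => b i + s * round ((x i - b i) / s)) i =
      s * ((x i - b i) / s - round ((x i - b i) / s)) := by
    rw [PiLp.sub_apply]
    field_simp
    ring
  rw [e, abs_mul, abs_of_pos hs]
  nlinarith

/-- The norm dominates each coordinate, so the ball lies in a cube of side `2 * ρ`, and an interval
of that length contains at most `⌊2 * ρ / s⌋₊ + 1` points of spacing `s`. -/
theorem encard_discPert_grid_le {s : ℝ} (hs : 0 < s) (b : Fin d → ℝ) {ρ : ℝ} (hρ : 0 ≤ ρ)
    (x : PiLp q fun _ : Fin d => ℝ) :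
    (discPert (grid d q s b) ρ x).encard ≤ ((⌊2 * ρ / s⌋₊ + 1) ^ d : ℕ) := by
  classical
  let J : Finset (Fin d → ℤ) := Fintype.piFinset fun i =>
    Finset.Icc ⌈(x i - ρ - b i) / s⌉ ⌊(x i + ρ - b i) / s⌋
  have hJ : J.card ≤ (⌊2 * ρ / s⌋₊ + 1) ^ d := by
    have h1 : ∀ i : Fin d, (Finset.Icc ⌈(x i - ρ - b i) / s⌉ ⌊(x i + ρ - b i) / s⌋).card ≤
        ⌊2 * ρ / s⌋₊ + 1 := by
      intro i
      rw [Int.card_Icc, Int.toNat_le]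
      have h2 : ⌊(x i + ρ - b i) / s⌋ - ⌈(x i - ρ - b i) / s⌉ ≤ (⌊2 * ρ / s⌋₊ : ℤ) := by
        rw [Int.natCast_floor_eq_floor (by positivity), Int.le_floor]
        push_cast
        have h3 := Int.floor_le ((x i + ρ - b i) / s)
        have h4 := Int.le_ceil ((x i - ρ - b i) / s)
        have h5 : (x i + ρ - b i) / s - (x i - ρ - b i) / s = 2 * ρ / s := by ring
        linarith
      push_cast
      linarith
    calc J.card = ∏ i, (Finset.Icc ⌈(x i - ρ - b i) / s⌉ ⌊(x i + ρ - b i) / s⌋).card :=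
          Fintype.card_piFinset _
      _ ≤ ∏ _i : Fin d, (⌊2 * ρ / s⌋₊ + 1) := Finset.prod_le_prod' fun i _ => h1 i
      _ = _ := by simp
  have hsub : discPert (grid d q s b) ρ x ⊆
      ↑(J.image fun j => (WithLp.toLp q fun i => b i + s * j i : PiLp q fun _ : Fin d => ℝ)) := by
    rintro c ⟨hc, hcg⟩
    choose j hj using hcg
    refine Finset.mem_coe.2 (Finset.mem_image.2 ⟨j, Fintype.mem_piFinset.2 fun i => ?_, ?_⟩)
    · have h1 : |c i - x i| ≤ ρ := by
        have h2 := PiLp.norm_apply_le (c - x) i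
        rw [← dist_eq_norm] at h2
        exact h2.trans hc
      rw [hj i, abs_le] at h1
      rw [Finset.mem_Icc, Int.ceil_le, Int.le_floor, div_le_iff₀ hs, le_div_iff₀ hs]
      constructor <;> linarith [h1.1, h1.2]
    · ext i
      exact (hj i).symm
  refine (Set.encard_le_encard hsub).trans ?_
  rw [Set.encard_coe_eq_coe_finsetCard]
  exact_mod_cast Finset.card_image_le.trans hJ

/-- Here `u` is `2 * ρ / s` for `ρ = (1 + γ) * r` and `s = 2 * r * γ / d`. The factor 2 on the right
absorbs the `log 2` from rounding. -/
theorem log_grid_count_le (hd : 0 < d) {γ : ℝ} (hγ : 0 < γ) {u : ℝ} (hu : u = d * (1 + 1 / γ)) :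
    Real.log ((⌊u⌋₊ + 1) ^ d : ℕ) ≤ 2 * (d * max 1 (Real.log (1 + 1 / γ) + Real.log d)) := by
  have hd' : (1 : ℝ) ≤ d := by exact_mod_cast hd
  have hγ' : 0 < 1 / γ := by positivity
  have hu1 : 1 ≤ u := by rw [hu]; nlinarith
  have hfl : (⌊u⌋₊ : ℝ) ≤ u := Nat.floor_le (by linarith)
  push_cast
  rw [Real.log_pow]
  have h1 : Real.log ((⌊u⌋₊ : ℝ) + 1) ≤ Real.log 2 + (Real.log (1 + 1 / γ) + Real.log d) := by
    calc Real.log ((⌊u⌋₊ : ℝ) + 1) ≤ Real.log (2 * ((1 + 1 / γ) * d)) := by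
          refine Real.log_le_log (by positivity) ?_
          rw [hu] at hfl hu1
          rw [hu]
          linarith
      _ = _ := by rw [Real.log_mul (by norm_num) (by positivity),
                    Real.log_mul (by positivity) (by positivity)]
  have h2 := Real.log_two_lt_d9
  have h3 := le_max_left 1 (Real.log (1 + 1 / γ) + Real.log d)
  have h4 := le_max_right 1 (Real.log (1 + 1 / γ) + Real.log d)
  calc d * Real.log ((⌊u⌋₊ : ℝ) + 1)
      ≤ d * (2 * max 1 (Real.log (1 + 1 / γ) + Real.log d)) := by
        gcongr
        linarith
    _ = _ := by ring

end Grid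

end TolerantRobust

end

theorem theorem5 :
    ∃ (K : ℝ) (p : ℕ), 0 < K ∧
      ∀ (d : ℕ), 0 < d → ∀ (q : ENNReal) [Fact (1 ≤ q)] (r γ : ℝ), 0 < r → 0 < γ →
        ∀ H : Set (TolerantRobust.Hyp (PiLp q fun _ : Fin d => ℝ)),
          H.Nonempty → TolerantRobust.classVCDim H < ⊤ →
            -- any cover whose induced perturbation sets have at most `k` elements
            (∀ (C : Set (PiLp q fun _ : Fin d => ℝ)) (k : ℕ),
              TolerantRobust.IsCover C (r * γ) →
              (∀ x, (TolerantRobust.discPert C ((1 + γ) * r) x).encard ≤ k) →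
              TolerantRobust.PrunedGuarantee K p r γ C H (max 1 (Real.log k))) ∧
            -- the grid of side-length `2 r γ / d`
            (∀ b : Fin d → ℝ,
              TolerantRobust.PrunedGuarantee K p r γ
                (TolerantRobust.grid d q (2 * r * γ / d) b) H
                (d * max 1 (Real.log (1 + 1 / γ) + Real.log d))) := by
  refine ⟨20000, 1, by norm_num, fun d hd q _ r γ hr hγ H hHne hH =>
    ⟨fun C k hC hk => ?_, fun b => ?_⟩⟩
  · exact TolerantRobust.prunedGuarantee_of_log_le hr hγ hC hk hHne hH (le_max_left _ _)
      (by have := le_max_left 1 (Real.log k); have := le_max_right 1 (Real.log k); linarith)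
  · have hd' : (1 : ℝ) ≤ d := by exact_mod_cast hd
    have hs : 0 < 2 * r * γ / d := by positivity
    have hcov := TolerantRobust.isCover_grid (q := q) hs b
    -- The side-length is chosen so that the covering radius, bounded uniformly in `q`, is exactly
    -- `r * γ`.
    rw [show (d : ℝ) * (2 * r * γ / d / 2) = r * γ by field_simp] at hcov
    refine TolerantRobust.prunedGuarantee_of_log_le hr hγ hcov
      (TolerantRobust.encard_discPert_grid_le hs b (by positivity)) hHne hH ?_
      (TolerantRobust.log_grid_count_le hd hγ (by field_simp; ring))
    have := le_max_left 1 (Real.log (1 + 1 / γ) + Real.log d)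
    nlinarith
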